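/- **Setting.** Fix $r\ge 1$, an integer $\bar m\ge 2$, $\nu>0$ and $\sigma\in\mathbb R$. For each $n$ let $p=p_n$ with $p\to\infty$, and let $$\boldsymbol x_i=\boldsymbol\eta(\boldsymbol\alpha_i)+\boldsymbol u_i\in\mathbb R^p,\qquad \mathbb E[\boldsymbol u_i\mid\mathscr F]=0,\qquad i=1,\dots,n,$$ where $\boldsymbol\alpha_i\in\mathbb R^r$ are random vectors, $\boldsymbol\eta=(\eta_1,\dots,\eta_p)'$ is a random function on $\mathbb R^r$, and $\mathscr F$ is the $\sigma$-field generated by $(\boldsymbol\alpha_i)_{i\le n}$ and $\boldsymbol\eta$. Write $\boldsymbol X=\boldsymbol H+\boldsymbol U$ for the $p\times n$ matrices with columns $\boldsymbol x_i$, $\boldsymbol\eta(\boldsymbol\alpha_i)$, $\boldsymbol u_i$. The row set is split as $[p]=\mathcal R^\dagger\cup\mathcal R^\ddagger$ (disjoint), with $p^\dagger=|\mathcal R^\dagger|\asymp p$ and $p^\ddagger=|\mathcal R^\ddagger|\asymp p$; a superscript $\dagger$ denotes restriction to the rows in $\mathcal R^\dagger$. For $\boldsymbol v,\boldsymbol w\in\mathbb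 R^{p^\dagger}$ let $\rho(\boldsymbol v,\boldsymbol w)=\frac1{p^\dagger}\|\boldsymbol v-\boldsymbol w\|^2$. All limits are as $n\to\infty$. For random sequences, $Y_n\lesssim_{\mathbb P}b_n$ (also written $Y_n=O_{\mathbb P}(b_n)$) means $\limsup_{\varepsilon\to\infty}\limsup_n\mathbb P[|Y_n/b_n|\ge\varepsilon]=0$, where a nonzero $Y_n$ over $b_n=0$ counts as infinite, and $Y_n\gtrsim_{\mathbb P}1$ means $1\lesssim_{\mathbb P}Y_n$. **Regularity conditions.** (a) For each $n$, $\boldsymbol\alpha_1,\dots,\boldsymbol\alpha_n$ are i.i.d. on a fixed compact convex support $\mathcal A\subset\mathbb R^r$, with a Lebesgue density on $\mathcal A$ that is bounded and bounded away from zero (uniformly in $n$). (b) Almost surely each $\eta_l$ is $\bar m$ times continuously differentiable on $\mathcal A$ (derivatives at the boundary being taken within $\mathcal A$), and all its partial derivatives of order at most $\bar m$ are bounded on $\mathcal A$ by a universal constant. (c) The $u_{il}$ ($i\le n$, $l\le p$) are independent over $i$ and $l$ conditionally on $\mathscr F$, and $\max_{i\le n,\,l\le p}\mathbb E[|u_{il}|^{2+\nu}\mid\mathscr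 F]=O_{\mathbb P}(1)$. **Theorem (Euclidean distance).** Suppose moreover that 1. $\frac1{p^\dagger}\sum_{l\in\mathcal R^\dagger}\mathbb E[u_{il}^2\mid\mathscr F]=\sigma^2$ almost surely, for all $i\in[n]$ and all $n$; 2. $\max_{i\in[n],\,l\in\mathcal R^\dagger}\mathbb E[|u_{il}|^{4+2\nu}\mid\mathscr F]=O_{\mathbb P}(1)$; 3. for every $\varepsilon>0$, $\displaystyle\lim_{\Delta\downarrow0}\limsup_{n\to\infty}\mathbb P\Big\{\max_{i\in[n]}\ \max_{j:\rho(\boldsymbol H^\dagger_{\cdot i},\boldsymbol H^\dagger_{\cdot j})<\Delta}\|\boldsymbol\alpha_i-\boldsymbol\alpha_j\|>\varepsilon\Big\}=0$; 4. for some $\underline c>0$, $\displaystyle\lim_{n\to\infty}\mathbb P\Big\{\min_{i\in[n]}s_{\min}\Big(\tfrac1{p^\dagger}\nabla\boldsymbol\eta^\dagger(\boldsymbol\alpha_i)'\,\nabla\boldsymbol\eta^\dagger(\boldsymbol\alpha_i)\Big)\ge\underline c\Big\}=1$, where $s_{\min}$ is the smallest singular value and $\nabla\boldsymbol\eta^\dagger$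 the $p^\dagger\times r$ Jacobian matrix; 5. $n^{4/\nu}(\log n)^{(\nu-2)/\nu}/p=O(1)$. Then the indirect-matching conditions hold with $a_n=((\log n)/p)^{1/4}$, $\rho_0=2\sigma^2$ and $\underline\varsigma=\bar\varsigma=2$. That is, $\rho_0\ge 0$, $a_n>0$ for all large $n$, $a_n\to0$, and $$\max_{1\le i\ne j\le n}\big|\rho(\boldsymbol X^\dagger_{\cdot i},\boldsymbol X^\dagger_{\cdot j})-\rho(\boldsymbol H^\dagger_{\cdot i},\boldsymbol H^\dagger_{\cdot j})-\rho_0\big|\lesssim_{\mathbb P}a_n,$$ $$\max_{i,j\le n:\ \boldsymbol\alpha_i\ne\boldsymbol\alpha_j}\frac{\rho(\boldsymbol H^\dagger_{\cdot i},\boldsymbol H^\dagger_{\cdot j})}{\|\boldsymbol\alpha_i-\boldsymbol\alpha_j\|^{\bar\varsigma}}\lesssim_{\mathbb P}1,\qquad \min_{i,j\le n:\ \boldsymbol\alpha_i\ne\boldsymbol\alpha_j}\frac{\rho(\boldsymbol H^\dagger_{\cdot i},\boldsymbol H^\dagger_{\cdot j})}{\|\boldsymbol\alpha_i-\boldsymbol\alpha_j\|^{\underline\varsigma}}\gtrsim_{\mathbb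 P}1.$$ -/

import Mathlib

open MeasureTheory ProbabilityTheory Filter Topology Asymptotics
open scoped ENNReal

noncomputable section

namespace NonlinearFactor

/-- `a ≍ b`, `a ≲ b` for deterministic sequences are `a =Θ[atTop] b`, `a =O[atTop] b`.
`BigOP μ Y b` is `Y ≲_P b`, i.e.
`limsup_{ε → ∞} limsup_n P(|Y_n / b_n| ≥ ε) = 0`.
The event is written as `ε |b_n| ≤ |Y_n|`, so that a vanishing denominator counts as an infinite
ratio; `b` may itself be random. -/
def BigOP {Ω : ℕ → Type*} [∀ n, MeasurableSpace (Ω n)] (μ : ∀ n, Measure (Ω n))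
    (Y b : ∀ n, Ω n → ℝ) : Prop :=
  limsup (fun ε : ℝ => limsup (fun n : ℕ => μ n {ω | ε * |b n ω| ≤ |Y n ω|}) atTop) atTop = 0

/-- `Y = O_P(1)` for random variables with values in `[0, ∞]`. -/
def StochBounded {Ω : ℕ → Type*} [∀ n, MeasurableSpace (Ω n)] (μ : ∀ n, Measure (Ω n))
    (Y : ∀ n, Ω n → ℝ≥0∞) : Prop :=
  limsup (fun ε : ℝ => limsup (fun n : ℕ => μ n {ω | ENNReal.ofReal ε ≤ Y n ω}) atTop) atTop = 0

/-- Conditional independence, given the σ-field `m`, of a family of real random variables: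
conditional probabilities of finite intersections factorize almost surely.
On standard Borel spaces this is Mathlib's `iCondIndepFun`, see `condIndepFamily_iff`. -/
def CondIndepFamily {Ω ι : Type*} (m : MeasurableSpace Ω) [MeasurableSpace Ω]
    (μ : Measure Ω) (Z : ι → Ω → ℝ) : Prop :=
  ∀ (s : Finset ι) (B : ι → Set ℝ), (∀ i ∈ s, MeasurableSet (B i)) →
    μ⟦⋂ i ∈ s, Z i ⁻¹' B i | m⟧ =ᵐ[μ] ∏ i ∈ s, μ⟦Z i ⁻¹' B i | m⟧

theorem condIndepFamily_iff {Ω ι : Type*} (m : MeasurableSpace Ω) [mΩ : MeasurableSpace Ω]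
    [StandardBorelSpace Ω] (hm : m ≤ mΩ) (μ : Measure Ω) [IsFiniteMeasure μ] (Z : ι → Ω → ℝ)
    (hZ : ∀ i, Measurable (Z i)) :
    CondIndepFamily m μ Z ↔ iCondIndepFun m hm Z (μ := μ) := by
  refine Iff.trans ?_
    (iCondIndepFun_iff_condExp_inter_preimage_eq_mul (hm' := hm) (μ := μ) _ Z hZ).symm
  exact ⟨fun h s B hB => h s B hB, fun h s B hB => h s hB⟩

/-- Smallest singular value of a real `r × r` matrix.  (Mathlib's singular values are indexed from
zero in decreasing order.) -/
def sMin {r : ℕ} (M : Matrix (Fin r) (Fin r) ℝ) : ℝ :=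
  (Matrix.toEuclideanLin M).singularValues (r - 1)

/-- The squared Euclidean distance `ρ(v, w) = ‖v - w‖² / d` of `d`-vectors. -/
def sqDist {ι : Type*} [Fintype ι] (v w : EuclideanSpace ℝ ι) : ℝ :=
  ‖v - w‖ ^ 2 / (Fintype.card ι : ℝ)

/-- The random elements of a nonlinear factor model with `n` units, `p` features and latent
variables in `ℝ^r`: latent variables `α i`, random latent functions `η l` and errors `u i l`. -/
structure Sample (r n p : ℕ) (Ω : Type*) [MeasurableSpace Ω] where
  α : Fin n → Ω → EuclideanSpace ℝ (Fin r)
  η : Fin p → Ω → EuclideanSpace ℝ (Fin r) → ℝ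
  u : Fin n → Fin p → Ω → ℝ
  measurable_α : ∀ i, Measurable (α i)
  measurable_η : ∀ l x, Measurable fun ω => η l ω x
  measurable_u : ∀ i l, Measurable (u i l)

namespace Sample

variable {r n p : ℕ} {Ω : Type*} [mΩ : MeasurableSpace Ω] (S : Sample r n p Ω)

/-- The σ-field `ℱ` generated by the latent variables and the latent functions. -/
@[reducible] def latentField : MeasurableSpace Ω :=
  (⨆ i, MeasurableSpace.comap (S.α i) inferInstance) ⊔
    ⨆ l, ⨆ x, MeasurableSpace.comap (fun ω => S.η l ω x) inferInstance

theorem latentField_le : S.latentField ≤ mΩ :=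
  sup_le (iSup_le fun i => (S.measurable_α i).comap_le)
    (iSup_le fun l => iSup_le fun x => (S.measurable_η l x).comap_le)

/-- `E[|u_il|^q | ℱ]`, as a conditional expectation with values in `[0, ∞]`. -/
def condMoment (μ : Measure Ω) (q : ℝ) (i : Fin n) (l : Fin p) : Ω → ℝ≥0∞ :=
  condLExp S.latentField μ fun ω => ENNReal.ofReal (|S.u i l ω| ^ q)

/-- Column `i` of the submatrix `H^†` of `H = (η_l(α_i))` with rows in `R`. -/
def colH (R : Finset (Fin p)) (i : Fin n) (ω : Ω) : EuclideanSpace ℝ R :=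
  WithLp.toLp 2 fun l => S.η l ω (S.α i ω)

/-- Column `i` of the submatrix `X^†` of `X = H + U` with rows in `R`. -/
def colX (R : Finset (Fin p)) (i : Fin n) (ω : Ω) : EuclideanSpace ℝ R :=
  WithLp.toLp 2 fun l => S.η l ω (S.α i ω) + S.u i l ω

/-- The Jacobian `∇η^†(x)`, with derivatives taken within the support `A`. -/
def jacobian (A : Set (EuclideanSpace ℝ (Fin r))) (R : Finset (Fin p)) (ω : Ω)
    (x : EuclideanSpace ℝ (Fin r)) : Matrix R (Fin r) ℝ :=
  Matrix.of fun l k => fderivWithin ℝ (S.η l ω) A x (EuclideanSpace.single k 1)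

/-- The normalized Gram matrix `∇η^†(x)' ∇η^†(x) / p^†`. -/
def gram (A : Set (EuclideanSpace ℝ (Fin r))) (R : Finset (Fin p)) (ω : Ω)
    (x : EuclideanSpace ℝ (Fin r)) : Matrix (Fin r) (Fin r) ℝ :=
  (1 / (R.card : ℝ)) • ((S.jacobian A R ω x).transpose * S.jacobian A R ω x)

end Sample

/-- The regularity conditions on a sequence of nonlinear factor models, including `E[u | ℱ] = 0`. -/
structure Regularities {r : ℕ} {p : ℕ → ℕ} {Ω : ℕ → Type*} [∀ n, MeasurableSpace (Ω n)]
    (μ : ∀ n, Measure (Ω n)) (S : ∀ n, Sample r n (p n) (Ω n))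
    (A : Set (EuclideanSpace ℝ (Fin r))) (m : ℕ) (ν : ℝ) : Prop where
  /-- The errors are integrable and have conditional mean zero. -/
  integrable_u : ∀ n i l, Integrable ((S n).u i l) (μ n)
  condMean_u : ∀ n i l, (μ n)[(S n).u i l | (S n).latentField] =ᵐ[μ n] 0
  /-- The latent variables are i.i.d. with a density on the compact convex support `A` that is
  bounded and bounded away from zero. -/
  isCompact : IsCompact A
  convex : Convex ℝ A
  indep_α : ∀ n, iIndepFun (S n).α (μ n)
  density_α : ∃ c C : ℝ, 0 < c ∧ ∀ n, ∃ f : EuclideanSpace ℝ (Fin r) → ℝ, Measurable f ∧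
    (∀ x ∈ A, c ≤ f x ∧ f x ≤ C) ∧
    ∀ i, (μ n).map ((S n).α i) = (volume.restrict A).withDensity fun x => ENNReal.ofReal (f x)
  /-- The latent functions are `m` times continuously differentiable on `A`, and all their partial
  derivatives of order at most `m` are bounded by a universal constant. -/
  smooth : ∀ n, ∀ᵐ ω ∂μ n, ∀ l, ContDiffOn ℝ m ((S n).η l ω) A
  bounded : ∃ C : ℝ, ∀ n, ∀ᵐ ω ∂μ n, ∀ l, ∀ k ≤ m, ∀ d : Fin k → Fin r, ∀ x ∈ A,
    |iteratedFDerivWithin ℝ k ((S n).η l ω) A x fun s => EuclideanSpace.single (d s) 1| ≤ C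
  /-- The errors are independent over `i` and `l` conditionally on `ℱ`, with conditional moments of
  order `2 + ν` that are bounded in probability uniformly over `i` and `l`. -/
  condIndep_u : ∀ n, CondIndepFamily (S n).latentField (μ n)
    fun q : Fin n × Fin (p n) => (S n).u q.1 q.2
  moment_u : StochBounded μ fun n ω => ⨆ i, ⨆ l, (S n).condMoment (μ n) (2 + ν) i l ω

/-- Indirect matching for the rows `R n` and the distance `ρ n`, with constants `ρ₀`, `ςlo`
(lower bound), `ςhi` (upper bound) and rate `a`. -/
structure IndirectMatching {r : ℕ} {p : ℕ → ℕ} {Ω : ℕ → Type*} [∀ n, MeasurableSpace (Ω n)]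
    (μ : ∀ n, Measure (Ω n)) (S : ∀ n, Sample r n (p n) (Ω n)) (R : ∀ n, Finset (Fin (p n)))
    (ρ : ∀ n, EuclideanSpace ℝ (R n) → EuclideanSpace ℝ (R n) → ℝ)
    (ρ₀ ςlo ςhi : ℝ) (a : ℕ → ℝ) : Prop where
  ρ₀_nonneg : 0 ≤ ρ₀
  ςlo_pos : 0 < ςlo
  ςhi_pos : 0 < ςhi
  a_pos : ∀ᶠ n in atTop, 0 < a n
  a_tendsto : Tendsto a atTop (𝓝 0)
  /-- `max_{i ≠ j} |ρ(X_i, X_j) - ρ(H_i, H_j) - ρ₀| ≲_P a_n`. -/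
  denoising : BigOP μ
    (fun n ω => ⨆ q : {q : Fin n × Fin n // q.1 ≠ q.2},
      |ρ n ((S n).colX (R n) q.1.1 ω) ((S n).colX (R n) q.1.2 ω)
        - ρ n ((S n).colH (R n) q.1.1 ω) ((S n).colH (R n) q.1.2 ω) - ρ₀|)
    (fun n _ => a n)
  /-- `max_{α_i ≠ α_j} ρ(H_i, H_j) / ‖α_i - α_j‖ ^ ςhi ≲_P 1`. -/
  upper : BigOP μ
    (fun n ω => ⨆ q : {q : Fin n × Fin n // (S n).α q.1 ω ≠ (S n).α q.2 ω},
      ρ n ((S n).colH (R n) q.1.1 ω) ((S n).colH (R n) q.1.2 ω)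
        / ‖(S n).α q.1.1 ω - (S n).α q.1.2 ω‖ ^ ςhi)
    (fun _ _ => 1)
  /-- `1 ≲_P min_{α_i ≠ α_j} ρ(H_i, H_j) / ‖α_i - α_j‖ ^ ςlo`. -/
  lower : BigOP μ (fun _ _ => 1)
    (fun n ω => ⨅ q : {q : Fin n × Fin n // (S n).α q.1 ω ≠ (S n).α q.2 ω},
      ρ n ((S n).colH (R n) q.1.1 ω) ((S n).colH (R n) q.1.2 ω)
        / ‖(S n).α q.1.1 ω - (S n).α q.1.2 ω‖ ^ ςlo)

end NonlinearFactor

end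

/-! Write D for the number of selected rows. Expanding the square, the denoising error of a pair (i,
j) is 1/D times a cross sum over l of 2(η_l(α_i) - η_l(α_j))(u_il - u_jl) - 2 u_il u_jl, plus two
sums of squares u_il² and u_jl², each centred at Dσ² (`Sample.sqDist_colX_sub`). Conditionally on
the latent field these are sums of independent centred terms, so a moment inequality of order q
(`exists_integral_abs_sum_rpow_le`) and Markov bound the probability that such a sum exceeds tD by a
multiple of (D t²)^(-q/2).

No exponential inequality is needed, because the number of events matches the available moments. The
squares depend on one index and have q = 2 + ν moments, so the union bound costs n. The cross sums
need n² events, but a product of independent errors keeps all q = 4 + 2ν moments, so their tail is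
the square of the former. With t of order a_n, everything is controlled by y and y², where y = n (D
a_n²)^(-(2+ν)/2) up to constants. As D a_n² is of order (p log n)^(1/2), the growth condition on p
makes y at most n^(-2/ν) times a power of log n (`tendsto_mul_card_mul_sq_rpow`).

The conditioning is made literal by a regular conditional law of the finite error vector
(`exists_condLaw`): for almost every outcome its coordinates are independent and centred, the tail
bounds apply to it on the event where the conditional moments are at most M, and integration returns
to the original measure (`exists_measure_denoising_le`).

The comparison of ρ(H_i, H_j) with ‖α_i - α_j‖² is calculus. The upper bound is the Lipschitz
property of the latent functions. For the lower bound, close pairs are handled by a first-order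
Taylor expansion and the nondegenerate Gram matrix (`Sample.le_sqDist_colH`). For distant pairs,
condition 3 keeps ρ(H_i, H_j) away from zero, while ‖α_i - α_j‖ is at most the diameter of A. -/

/-! ### Elementary inequalities for real powers. -/

theorem rpow_one_add_le_quadratic {q x : ℝ} (hq : 2 ≤ q) (hx1 : -1 < x) (hx2 : x ≤ 1) :
    (1 + x) ^ q ≤ 1 + q * x + q * (q - 1) * 2 ^ q * x ^ 2 := by
  have hpos : 0 < 1 + x := by linarith
  have tangent : ∀ s : ℝ, 1 ≤ s → (1 + x) ^ s ≤ 1 + s * x * (1 + x) ^ (s - 1) := by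
    intro s hs
    -- Bernoulli's inequality at the reciprocal, 1/(1+x) = 1 + (-x/(1+x)); multiplying by (1+x)^s
    -- turns it into an upper bound.
    have h := one_add_mul_self_le_rpow_one_add (s := -x / (1 + x)) (p := s)
      (by rw [le_div_iff₀ hpos]; linarith) hs
    have e : 1 + -x / (1 + x) = (1 + x)⁻¹ := by field_simp; ring
    rw [e, Real.inv_rpow hpos.le] at h
    have hp : 0 < (1 + x) ^ s := Real.rpow_pos_of_pos hpos s
    have h2 := mul_le_mul_of_nonneg_left h hp.le
    rw [mul_inv_cancel₀ hp.ne', mul_add, mul_one] at h2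
    have e2 : (1 + x) ^ s = (1 + x) ^ (s - 1) * (1 + x) := by
      rw [← Real.rpow_add_one hpos.ne']; ring_nf
    have e3 : (1 + x) ^ s * (s * (-x / (1 + x))) = -(s * x * (1 + x) ^ (s - 1)) := by
      rw [e2]; field_simp
    linarith
  have h1 := tangent q (by linarith)
  -- One more order of expansion: for x ≥ 0 the tangent bound is used again with exponent q - 1, and
  -- for x ≤ 0 Bernoulli's lower bound reverses on multiplication by x.
  have h2 : x * (1 + x) ^ (q - 1) ≤ x + (q - 1) * 2 ^ q * x ^ 2 := by
    rcases le_total 0 x with h0 | h0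
    · have h3 := tangent (q - 1) (by linarith)
      have h4 : (1 + x) ^ (q - 1 - 1) ≤ 2 ^ q :=
        (Real.rpow_le_rpow hpos.le (by linarith) (by linarith)).trans
          (Real.rpow_le_rpow_of_exponent_le one_le_two (by linarith))
      have h5 : (q - 1) * x * (1 + x) ^ (q - 1 - 1) ≤ (q - 1) * x * 2 ^ q :=
        mul_le_mul_of_nonneg_left h4 (mul_nonneg (by linarith) h0)
      calc x * (1 + x) ^ (q - 1) ≤ x * (1 + (q - 1) * x * 2 ^ q) :=
            mul_le_mul_of_nonneg_left (by linarith) h0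
        _ = _ := by ring
    · have h3 := one_add_mul_self_le_rpow_one_add (s := x) (p := q - 1) hx1.le (by linarith)
      have h4 : (1 : ℝ) ≤ 2 ^ q := Real.one_le_rpow one_le_two (by linarith)
      have h5 : x * (1 + x) ^ (q - 1) ≤ x * (1 + (q - 1) * x) :=
        mul_le_mul_of_nonpos_left h3 h0
      have h6 : 0 ≤ (q - 1) * x ^ 2 * (2 ^ q - 1) :=
        mul_nonneg (mul_nonneg (by linarith) (sq_nonneg x)) (by linarith)
      nlinarith
  have h3 := mul_le_mul_of_nonneg_left h2 (show 0 ≤ q by linarith)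
  nlinarith

/-- The constant of `abs_add_rpow_le`. -/
noncomputable def expansionConst (q : ℝ) : ℝ := q * (q - 1) * 2 ^ q + 3 ^ q + q * 2 ^ q

theorem one_le_expansionConst {q : ℝ} (hq : 2 ≤ q) : 1 ≤ expansionConst q := by
  have h1 : (1 : ℝ) ≤ 3 ^ q := Real.one_le_rpow (by norm_num) (by linarith)
  have h2 : 0 ≤ q * (q - 1) * 2 ^ q :=
    mul_nonneg (mul_nonneg (by linarith) (by linarith)) (by positivity)
  have h3 : 0 ≤ q * 2 ^ q := mul_nonneg (by linarith) (by positivity)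
  unfold expansionConst; linarith

/-- If |a| ≤ 2|b|, every term is absorbed by |b|^q; otherwise |b/a| < 1/2 and the quadratic bound
applies after factoring out |a|^q. The linear term is kept exactly, since it integrates to zero when
b is centred and independent of a. The three summands of `expansionConst` come from the quadratic
term, from |a + b| ≤ 3|b|, and from the linear term in the first case. -/
theorem abs_add_rpow_le {q : ℝ} (hq : 2 ≤ q) (a b : ℝ) :
    |a + b| ^ q ≤ |a| ^ q + q * (a * |a| ^ (q - 2)) * b
      + expansionConst q * (|a| ^ (q - 2) * b ^ 2 + |b| ^ q) := by
  have hC1 : 0 ≤ q * (q - 1) * (2 : ℝ) ^ q :=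
    mul_nonneg (mul_nonneg (by linarith) (by linarith)) (by positivity)
  have hC2 : (0 : ℝ) ≤ 3 ^ q := by positivity
  have hC3 : 0 ≤ q * (2 : ℝ) ^ q := mul_nonneg (by linarith) (by positivity)
  have hA : 0 ≤ |a| ^ (q - 2) := by positivity
  have hB : 0 ≤ |b| ^ q := by positivity
  by_cases hab : |a| ≤ 2 * |b|
  · have h1 : |a + b| ^ q ≤ 3 ^ q * |b| ^ q := by
      rw [← Real.mul_rpow (by norm_num) (abs_nonneg b)]
      exact Real.rpow_le_rpow (abs_nonneg _) ((abs_add_le a b).trans (by linarith)) (by linarith)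
    have h2 : -(q * (a * |a| ^ (q - 2)) * b) ≤ q * 2 ^ q * |b| ^ q := by
      have e : |a * |a| ^ (q - 2) * b| ≤ 2 ^ q * |b| ^ q := by
        rw [abs_mul, abs_mul, abs_of_nonneg hA]
        rcases eq_or_ne b 0 with rfl | hb
        · simp; positivity
        have hb' : 0 < 2 * |b| := by positivity
        calc |a| * |a| ^ (q - 2) * |b| ≤ (2 * |b|) * (2 * |b|) ^ (q - 2) * (2 * |b|) := by
              have := Real.rpow_le_rpow (abs_nonneg a) hab (show 0 ≤ q - 2 by linarith)
              gcongr
              linarith [abs_nonneg b]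
          _ = (2 * |b|) ^ (q - 2 + 2) := by
              rw [Real.rpow_add hb', Real.rpow_two]; ring
          _ = 2 ^ q * |b| ^ q := by
              rw [sub_add_cancel, Real.mul_rpow (by norm_num) (abs_nonneg b)]
      have := mul_le_mul_of_nonneg_left ((neg_le_abs _).trans e) (show 0 ≤ q by linarith)
      nlinarith
    have h3 : 0 ≤ |a| ^ q := by positivity
    have h4 : 0 ≤ |a| ^ (q - 2) * b ^ 2 := by positivity
    unfold expansionConst
    nlinarith [mul_nonneg hC1 hB, mul_nonneg (add_nonneg (add_nonneg hC1 hC2) hC3) h4]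
  · push Not at hab
    have ha : a ≠ 0 := by
      rintro rfl
      simp at hab
      linarith [abs_nonneg b]
    have ha' : 0 < |a| := abs_pos.2 ha
    have hx : |b / a| ≤ 1 / 2 := by
      rw [abs_div, div_le_iff₀ ha']; linarith
    obtain ⟨hx1, hx2⟩ := abs_le.1 hx
    have h := rpow_one_add_le_quadratic hq (x := b / a) (by linarith) (by linarith)
    have h1 : |a + b| ^ q = |a| ^ q * (1 + b / a) ^ q := by
      rw [← Real.mul_rpow ha'.le (by linarith)]
      congr 1
      have : a + b = a * (1 + b / a) := by field_simp
      rw [this, abs_mul, abs_of_nonneg (by linarith : 0 ≤ 1 + b / a)]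
    have h2 : |a| ^ q = |a| ^ (q - 2) * a ^ 2 := by
      rw [← sq_abs a, ← Real.rpow_two, ← Real.rpow_add ha', sub_add_cancel]
    have h3 := mul_le_mul_of_nonneg_left h (show 0 ≤ |a| ^ q by positivity)
    rw [h1]
    refine h3.trans ?_
    have e : |a| ^ q * (1 + q * (b / a) + q * (q - 1) * 2 ^ q * (b / a) ^ 2)
        = |a| ^ q + q * (a * |a| ^ (q - 2)) * b
          + q * (q - 1) * 2 ^ q * (|a| ^ (q - 2) * b ^ 2) := by
      rw [h2]; field_simp
    rw [e]
    have h4 : 0 ≤ |a| ^ (q - 2) * b ^ 2 := by positivity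
    unfold expansionConst
    nlinarith [mul_nonneg hC1 hB, mul_nonneg hC2 h4, mul_nonneg hC3 h4, mul_nonneg hC2 hB,
      mul_nonneg hC3 hB]

theorem abs_add_rpow_le_two_rpow {q : ℝ} (hq : 0 ≤ q) (a b : ℝ) :
    |a + b| ^ q ≤ 2 ^ q * (|a| ^ q + |b| ^ q) := by
  have ha : 0 ≤ |a| ^ q := by positivity
  have hb : 0 ≤ |b| ^ q := by positivity
  have key : ∀ x : ℝ, 0 ≤ x → |a| ≤ x → |b| ≤ x → |a + b| ^ q ≤ 2 ^ q * x ^ q := by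
    intro x hx h1 h2
    rw [← Real.mul_rpow zero_le_two hx]
    exact Real.rpow_le_rpow (abs_nonneg _) ((abs_add_le a b).trans (by linarith)) hq
  rcases le_total |a| |b| with h | h
  · refine (key |b| (abs_nonneg b) h le_rfl).trans ?_
    gcongr; linarith
  · refine (key |a| (abs_nonneg a) le_rfl h).trans ?_
    gcongr; linarith

/-- Splitting at |x| = t replaces Hölder's inequality by a bound linear in |x|^q, which lets the
moment recursion close; t is tuned later. -/
theorem abs_rpow_sub_two_le {q t : ℝ} (hq : 2 ≤ q) (ht : 0 < t) (x : ℝ) :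
    |x| ^ (q - 2) ≤ t ^ (q - 2) + |x| ^ q / t ^ 2 := by
  rcases le_total |x| t with h | h
  · have := Real.rpow_le_rpow (abs_nonneg x) h (show 0 ≤ q - 2 by linarith)
    have h2 : 0 ≤ |x| ^ q / t ^ 2 := by positivity
    linarith
  · have hx : 0 < |x| := ht.trans_le h
    have h2 : |x| ^ (q - 2) ≤ |x| ^ q / t ^ 2 := by
      rw [le_div_iff₀ (by positivity), ← sub_add_cancel q 2, add_sub_cancel_right,
        Real.rpow_add hx, Real.rpow_two]
      gcongr
    have h3 : 0 ≤ t ^ (q - 2) := by positivity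
    linarith

/-! ### Moments and tails of sums of independent centred variables. -/

section Moments

variable {Ω : Type*} [MeasurableSpace Ω] {P : Measure Ω}

theorem integrable_abs_add_rpow {q : ℝ} (hq : 2 ≤ q)
    {X Y : Ω → ℝ} (hX : Measurable X) (hY : Measurable Y)
    (hXq : Integrable (fun ω => |X ω| ^ q) P) (hYq : Integrable (fun ω => |Y ω| ^ q) P) :
    Integrable (fun ω => |X ω + Y ω| ^ q) P := by
  refine ((hXq.add hYq).const_mul (2 ^ q)).mono'
    ((hX.add hY).norm.pow_const q).aestronglyMeasurable (.of_forall fun ω => ?_)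
  rw [Real.norm_of_nonneg (by positivity)]
  exact abs_add_rpow_le_two_rpow (by linarith) _ _

variable [IsProbabilityMeasure P]

theorem integrable_abs_rpow_of_le {q s : ℝ} (hs : 0 ≤ s) (hsq : s ≤ q)
    {X : Ω → ℝ} (hX : Measurable X) (h : Integrable (fun ω => |X ω| ^ q) P) :
    Integrable (fun ω => |X ω| ^ s) P := by
  refine ((integrable_const 1).add h).mono' (by fun_prop) (.of_forall fun ω => ?_)
  rw [Real.norm_of_nonneg (by positivity)]
  simp only [Pi.add_apply]
  rcases le_total |X ω| 1 with h1 | h1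
  · have := Real.rpow_le_one (abs_nonneg (X ω)) h1 hs
    have : 0 ≤ |X ω| ^ q := by positivity
    linarith
  · have := Real.rpow_le_rpow_of_exponent_le h1 hsq
    linarith

/-- One step of the recursion for partial sums: the linear term of the expansion vanishes by
independence and centring, and the quadratic term factorizes. The second moment of the new term is
at most 1 + M ≤ 2M. -/
theorem integral_abs_add_rpow_le {q : ℝ} (hq : 2 ≤ q)
    {X Y : Ω → ℝ} (hX : Measurable X) (hY : Measurable Y)
    (hXq : Integrable (fun ω => |X ω| ^ q) P) (hYq : Integrable (fun ω => |Y ω| ^ q) P)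
    (hY0 : ∫ ω, Y ω ∂P = 0) (hind : IndepFun X Y P) {t M : ℝ} (ht : 0 < t) (hM : 1 ≤ M)
    (hYM : ∫ ω, |Y ω| ^ q ∂P ≤ M) :
    ∫ ω, |X ω + Y ω| ^ q ∂P ≤ ∫ ω, |X ω| ^ q ∂P
      + expansionConst q * M * (2 * (t ^ (q - 2) + (∫ ω, |X ω| ^ q ∂P) / t ^ 2) + 1) := by
  have hY1 : Integrable Y P := by
    have := integrable_abs_rpow_of_le (zero_le_one) (by linarith : 1 ≤ q) hY hYq
    simp only [Real.rpow_one] at this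
    exact (integrable_norm_iff hY.aestronglyMeasurable).1 this
  have hY2 : Integrable (fun ω => Y ω ^ 2) P := by
    have := integrable_abs_rpow_of_le (zero_le_two) hq hY hYq
    simpa only [Real.rpow_two, sq_abs] using this
  have hX1 : Integrable (fun ω => X ω * |X ω| ^ (q - 2)) P := by
    have := integrable_abs_rpow_of_le (by linarith : 0 ≤ q - 1) (by linarith : q - 1 ≤ q) hX hXq
    refine this.mono' (by fun_prop) (.of_forall fun ω => ?_)
    rw [norm_mul, Real.norm_eq_abs, Real.norm_of_nonneg (by positivity)]
    rcases eq_or_ne (X ω) 0 with h | h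
    · simp [h]; positivity
    · have : 0 < |X ω| := abs_pos.2 h
      rw [mul_comm, ← Real.rpow_add_one this.ne']
      apply le_of_eq; ring_nf
  have hX2 := integrable_abs_rpow_of_le (by linarith : 0 ≤ q - 2) (by linarith : q - 2 ≤ q) hX hXq
  have hi1 : IndepFun (fun ω => X ω * |X ω| ^ (q - 2)) Y P :=
    hind.comp (φ := fun x => x * |x| ^ (q - 2)) (ψ := id) (by fun_prop) measurable_id
  have hi2 : IndepFun (fun ω => |X ω| ^ (q - 2)) (fun ω => Y ω ^ 2) P :=
    hind.comp (φ := fun x => |x| ^ (q - 2)) (ψ := fun y => y ^ 2) (by fun_prop) (by fun_prop)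
  have e1 : ∫ ω, X ω * |X ω| ^ (q - 2) * Y ω ∂P = 0 := by
    rw [hi1.integral_fun_mul_eq_mul_integral hX1.aestronglyMeasurable hY1.aestronglyMeasurable,
      hY0, mul_zero]
  have e2 := hi2.integral_fun_mul_eq_mul_integral hX2.aestronglyMeasurable
    hY2.aestronglyMeasurable
  have I1 : Integrable (fun ω => X ω * |X ω| ^ (q - 2) * Y ω) P := hi1.integrable_mul hX1 hY1
  have I2 : Integrable (fun ω => |X ω| ^ (q - 2) * Y ω ^ 2) P := hi2.integrable_mul hX2 hY2
  have hC := one_le_expansionConst hq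
  have hS : 0 ≤ ∫ ω, |X ω| ^ q ∂P := integral_nonneg fun ω => by positivity
  have b1 : ∫ ω, |X ω| ^ (q - 2) ∂P ≤ t ^ (q - 2) + (∫ ω, |X ω| ^ q ∂P) / t ^ 2 := by
    calc ∫ ω, |X ω| ^ (q - 2) ∂P ≤ ∫ ω, (t ^ (q - 2) + |X ω| ^ q / t ^ 2) ∂P :=
          integral_mono hX2 ((integrable_const _).add (hXq.div_const _))
            fun ω => abs_rpow_sub_two_le hq ht _
      _ = _ := by
          rw [integral_add (integrable_const _) (hXq.div_const _), integral_div]; simp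
  have b2 : ∫ ω, Y ω ^ 2 ∂P ≤ 2 * M := by
    calc ∫ ω, Y ω ^ 2 ∂P ≤ ∫ ω, (1 + |Y ω| ^ q) ∂P := by
          refine integral_mono hY2 ((integrable_const _).add hYq) fun ω => ?_
          show Y ω ^ 2 ≤ 1 + |Y ω| ^ q
          rw [← sq_abs]
          rcases le_total |Y ω| 1 with h1 | h1
          · have : 0 ≤ |Y ω| ^ q := by positivity
            have := pow_le_one₀ (abs_nonneg (Y ω)) h1 (n := 2)
            linarith
          · have := Real.rpow_le_rpow_of_exponent_le h1 hq
            rw [Real.rpow_two] at this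
            linarith
      _ = 1 + ∫ ω, |Y ω| ^ q ∂P := by
          rw [integral_add (integrable_const _) hYq]; simp
      _ ≤ 2 * M := by linarith
  have b0 : 0 ≤ ∫ ω, Y ω ^ 2 ∂P := integral_nonneg fun ω => by positivity
  have b3 : 0 ≤ t ^ (q - 2) + (∫ ω, |X ω| ^ q ∂P) / t ^ 2 := by positivity
  calc ∫ ω, |X ω + Y ω| ^ q ∂P
      ≤ ∫ ω, (|X ω| ^ q + q * (X ω * |X ω| ^ (q - 2) * Y ω)
        + expansionConst q * (|X ω| ^ (q - 2) * Y ω ^ 2 + |Y ω| ^ q)) ∂P := by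
        refine integral_mono (integrable_abs_add_rpow hq hX hY hXq hYq)
          ((hXq.add (I1.const_mul q)).add ((I2.add hYq).const_mul _)) fun ω => ?_
        exact (abs_add_rpow_le hq (X ω) (Y ω)).trans_eq (by rw [mul_assoc q])
    _ = ∫ ω, |X ω| ^ q ∂P + expansionConst q *
          ((∫ ω, |X ω| ^ (q - 2) ∂P) * (∫ ω, Y ω ^ 2 ∂P) + ∫ ω, |Y ω| ^ q ∂P) := by
        have J1 := hXq.add (I1.const_mul q)
        have J2 := (I2.add hYq).const_mul (expansionConst q)
        simp only [Pi.add_def] at J1 J2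
        rw [integral_add J1 J2, integral_add hXq (I1.const_mul q), integral_const_mul,
          integral_const_mul, integral_add I2 hYq, e1, e2]
        simp
    _ ≤ _ := by
        have := mul_le_mul b1 b2 b0 b3
        rw [mul_assoc (expansionConst q)]
        gcongr
        nlinarith

/-- A moment inequality of Marcinkiewicz–Zygmund type for sums of independent centered random
variables. -/
theorem exists_integral_abs_sum_rpow_le {q : ℝ} (hq : 2 ≤ q) {M : ℝ} (hM : 1 ≤ M) :
    ∃ L : ℝ, 0 ≤ L ∧ ∀ {Ω : Type} [MeasurableSpace Ω] (P : Measure Ω) [IsProbabilityMeasure P]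
      {κ : Type} (T : Finset κ) (Y : κ → Ω → ℝ), (∀ l, Measurable (Y l)) →
      (∀ l ∈ T, Integrable (fun ω => |Y l ω| ^ q) P) → (∀ l ∈ T, ∫ ω, Y l ω ∂P = 0) →
      (∀ l ∈ T, ∫ ω, |Y l ω| ^ q ∂P ≤ M) →
      (∀ s : Finset κ, ∀ l ∉ s, IndepFun (fun ω => ∑ k ∈ s, Y k ω) (Y l) P) →
      Integrable (fun ω => |∑ l ∈ T, Y l ω| ^ q) P ∧
        ∫ ω, |∑ l ∈ T, Y l ω| ^ q ∂P ≤ L * (T.card : ℝ) ^ (q / 2) := by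
  have hC := one_le_expansionConst hq
  set C := expansionConst q
  set B := √(4 * C * M) with hB
  have hCM : 1 ≤ C * M := one_le_mul_of_one_le_of_one_le hC hM
  have hB2 : B ^ 2 = 4 * C * M := Real.sq_sqrt (by nlinarith)
  have hBpos : 0 < B := Real.sqrt_pos.2 (by nlinarith)
  have hBq : 0 ≤ B ^ (q - 2) := by positivity
  -- L is chosen so that 2CM B^(q-2) + CM = L/2; the choice B² = 4CM makes the feedback of the
  -- previous moment contribute the other half.
  set L := 4 * (C * M) * B ^ (q - 2) + 2 * (C * M) with hL
  have hL0 : 0 ≤ L := by positivity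
  refine ⟨L, hL0, ?_⟩
  intro Ω _ P _ κ T Y hYm
  classical
  induction T using Finset.induction_on with
  | empty =>
    intros
    have : q ≠ 0 := by linarith
    have : q / 2 ≠ 0 := by positivity
    simp [Real.zero_rpow, *]
  | insert l T hl ih =>
    intro hint h0 hb hind
    obtain ⟨ih1, ih2⟩ := ih (fun k hk => hint k (Finset.mem_insert_of_mem hk))
      (fun k hk => h0 k (Finset.mem_insert_of_mem hk))
      (fun k hk => hb k (Finset.mem_insert_of_mem hk)) hind
    have hl' := Finset.mem_insert_self l T
    have hS : Measurable fun ω => ∑ k ∈ T, Y k ω := by fun_prop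
    simp only [Finset.sum_insert hl, add_comm (Y l _)]
    refine ⟨integrable_abs_add_rpow hq hS (hYm l) ih1 (hint l hl'), ?_⟩
    rw [Finset.card_insert_of_notMem hl]
    rcases Nat.eq_zero_or_pos T.card with hk | hk
    · rw [Finset.card_eq_zero] at hk
      subst hk
      simp only [Finset.sum_empty, zero_add, Finset.card_empty, Nat.cast_one, Real.one_rpow,
        mul_one]
      have : M ≤ C * M := by nlinarith
      have := hb l hl'
      have : 0 ≤ 4 * (C * M) * B ^ (q - 2) := by positivity
      linarith
    · set k : ℝ := (T.card : ℝ) with hkdef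
      have hk1 : (1 : ℝ) ≤ k := Nat.one_le_cast.2 hk
      have hkpos : 0 < k := by linarith
      -- The splitting level is of the order of the standard deviation of a sum of k terms.
      set t := B * √k with ht
      have htpos : 0 < t := by positivity
      have ht2 : t ^ 2 = 4 * C * M * k := by rw [ht, mul_pow, hB2, Real.sq_sqrt hkpos.le]
      set J := k ^ (q / 2 - 1) with hJ
      have hJ1 : 1 ≤ J := Real.one_le_rpow hk1 (by linarith)
      have htq : t ^ (q - 2) = B ^ (q - 2) * J := by
        rw [ht, Real.mul_rpow hBpos.le (Real.sqrt_nonneg _), Real.sqrt_eq_rpow,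
          ← Real.rpow_mul hkpos.le, hJ]
        ring_nf
      have hkJ : k ^ (q / 2) = k * J := by
        rw [hJ, mul_comm, ← Real.rpow_add_one hkpos.ne', sub_add_cancel]
      have step := integral_abs_add_rpow_le hq hS (hYm l) ih1 (hint l hl') (h0 l hl')
        (hind T l hl) htpos hM (hb l hl')
      -- Since k J = k^(q/2), an increment of at most L J is exactly what the induction allows.
      have hgrow : k * J + J ≤ (k + 1) ^ (q / 2) := by
        have h1 : (k + 1) ^ (q / 2) = (k + 1) * (k + 1) ^ (q / 2 - 1) := by
          rw [mul_comm, ← Real.rpow_add_one (by positivity), sub_add_cancel]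
        have h2 : J ≤ (k + 1) ^ (q / 2 - 1) :=
          Real.rpow_le_rpow hkpos.le (by linarith) (by linarith)
        rw [h1]; nlinarith
      set I := ∫ ω, |∑ k ∈ T, Y k ω| ^ q ∂P
      rw [hkJ] at ih2
      have h3 : I / t ^ 2 ≤ L * J / (4 * C * M) := by
        rw [ht2]
        rw [div_le_div_iff₀ (by positivity) (by positivity)]
        calc I * (4 * C * M) ≤ L * (k * J) * (4 * C * M) := by gcongr
          _ = _ := by ring
      have h4 : C * M * (2 * (L * J / (4 * C * M))) = L * J / 2 := by
        field_simp; ring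
      push_cast
      refine step.trans ?_
      rw [htq]
      have h5 : C * M * (2 * (B ^ (q - 2) * J + I / t ^ 2) + 1) ≤ L * J := by
        calc C * M * (2 * (B ^ (q - 2) * J + I / t ^ 2) + 1)
            ≤ C * M * (2 * (B ^ (q - 2) * J + L * J / (4 * C * M)) + J) := by gcongr
          _ = (2 * (C * M) * B ^ (q - 2) + C * M) * J
              + C * M * (2 * (L * J / (4 * C * M))) := by ring
          _ = L * J := by rw [h4, hL]; ring
      calc _ ≤ L * (k * J) + L * J := add_le_add ih2 h5
        _ = L * (k * J + J) := by ring
        _ ≤ _ := by gcongr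

theorem exists_measure_abs_sum_ge_le {q : ℝ} (hq : 2 ≤ q) {M : ℝ} (hM : 1 ≤ M) :
    ∃ L : ℝ, 0 ≤ L ∧ ∀ {Ω : Type} [MeasurableSpace Ω] (P : Measure Ω) [IsProbabilityMeasure P]
      {κ : Type} (T : Finset κ) (Y : κ → Ω → ℝ), (∀ l, Measurable (Y l)) →
      (∀ l ∈ T, Integrable (fun ω => |Y l ω| ^ q) P) → (∀ l ∈ T, ∫ ω, Y l ω ∂P = 0) →
      (∀ l ∈ T, ∫ ω, |Y l ω| ^ q ∂P ≤ M) →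
      (∀ s : Finset κ, ∀ l ∉ s, IndepFun (fun ω => ∑ k ∈ s, Y k ω) (Y l) P) →
      0 < T.card → ∀ t : ℝ, 0 < t →
      P {ω | t * T.card ≤ |∑ l ∈ T, Y l ω|} ≤ ENNReal.ofReal (L * (T.card * t ^ 2) ^ (-(q / 2))) := by
  obtain ⟨L, hL, h⟩ := exists_integral_abs_sum_rpow_le hq hM
  refine ⟨L, hL, ?_⟩
  intro Ω _ P _ κ T Y hYm hint h0 hb hind hT t ht
  obtain ⟨h1, h2⟩ := h P T Y hYm hint h0 hb hind
  have hD : (0 : ℝ) < T.card := by exact_mod_cast hT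
  set D : ℝ := (T.card : ℝ)
  have hmk := mul_meas_ge_le_integral_of_nonneg (μ := P)
    (f := fun ω => |∑ l ∈ T, Y l ω| ^ q) (.of_forall fun ω => by positivity) h1 ((t * D) ^ q)
  have hsub : {ω | t * D ≤ |∑ l ∈ T, Y l ω|} ⊆ {ω | (t * D) ^ q ≤ |∑ l ∈ T, Y l ω| ^ q} :=
    fun ω hω => Real.rpow_le_rpow (by positivity) hω (by linarith)
  rw [← ofReal_measureReal]
  refine ENNReal.ofReal_le_ofReal ?_
  have hpos : 0 < (t * D) ^ q := by positivity
  have h3 : P.real {ω | t * D ≤ |∑ l ∈ T, Y l ω|} * (t * D) ^ q ≤ L * D ^ (q / 2) := by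
    refine (mul_le_mul_of_nonneg_right (measureReal_mono hsub) hpos.le).trans ?_
    rw [mul_comm]; exact hmk.trans h2
  rw [← le_div_iff₀ hpos] at h3
  refine h3.trans (le_of_eq ?_)
  rw [Real.rpow_neg (by positivity), Real.mul_rpow hD.le (by positivity),
    Real.mul_rpow ht.le hD.le, ← Real.rpow_two, ← Real.rpow_mul ht.le,
    show D ^ q = D ^ (q / 2) * D ^ (q / 2) by rw [← Real.rpow_add hD]; ring_nf,
    show (2 : ℝ) * (q / 2) = q by ring]
  field_simp

end Moments

/-! ### Tails of the squared errors and of the cross terms. -/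

/-- The blocks {a k, b k} are disjoint for distinct k. Within a block a k = b k is allowed, so the
lemma serves both the squares (a = b) and the products. -/
theorem indepFun_sum_blocks {Ω ι κ : Type*} [MeasurableSpace Ω] {P : Measure Ω}
    {X : ι → Ω → ℝ} (hX : iIndepFun X P) (hXm : ∀ i, Measurable (X i)) {a b : κ → ι}
    (haa : ∀ k l, k ≠ l → a k ≠ a l) (hab : ∀ k l, k ≠ l → a k ≠ b l)
    (hbb : ∀ k l, k ≠ l → b k ≠ b l) {g : κ → ℝ → ℝ → ℝ}
    (hg : ∀ k, Measurable (Function.uncurry (g k))) (s : Finset κ) {l : κ} (hl : l ∉ s) :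
    IndepFun (fun ω => ∑ k ∈ s, g k (X (a k) ω) (X (b k) ω))
      (fun ω => g l (X (a l) ω) (X (b l) ω)) P := by
  classical
  let S : Finset ι := s.image a ∪ s.image b
  let T : Finset ι := {a l, b l}
  have hST : Disjoint S T := by
    rw [Finset.disjoint_left]
    intro i hi hiT
    simp only [S, T, Finset.mem_union, Finset.mem_image, Finset.mem_insert,
      Finset.mem_singleton] at hi hiT
    rcases hi with ⟨k, hk, rfl⟩ | ⟨k, hk, rfl⟩ <;>
    · have hkl : k ≠ l := fun h => hl (h ▸ hk)
      rcases hiT with h | h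
      · first | exact haa k l hkl h | exact hab l k hkl.symm h.symm
      · first | exact hab k l hkl h | exact hbb k l hkl h
  have h := hX.indepFun_finset S T hST hXm
  let ext (U : Finset ι) (x : U → ℝ) (i : ι) : ℝ := if h : i ∈ U then x ⟨i, h⟩ else 0
  have hext : ∀ U i, Measurable fun x => ext U x i := by
    intro U i
    by_cases h : i ∈ U
    · simp only [ext, h, dite_true]; exact measurable_pi_apply _
    · simp only [ext, h, dite_false]; exact measurable_const
  have hm : ∀ U k, Measurable fun x => g k (ext U x (a k)) (ext U x (b k)) := fun U k =>
    (hg k).comp ((hext U (a k)).prodMk (hext U (b k)))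
  have h2 := h.comp (φ := fun x => ∑ k ∈ s, g k (ext S x (a k)) (ext S x (b k)))
    (ψ := fun x => g l (ext T x (a l)) (ext T x (b l)))
    (Finset.measurable_fun_sum _ fun k _ => hm S k) (hm T l)
  convert h2 using 1
  · ext ω
    refine Finset.sum_congr rfl fun k hk => ?_
    have h1 : a k ∈ S := Finset.mem_union_left _ (Finset.mem_image_of_mem a hk)
    have h2 : b k ∈ S := Finset.mem_union_right _ (Finset.mem_image_of_mem b hk)
    simp only [ext, h1, h2, dite_true]
  · ext ω
    have h1 : a l ∈ T := by simp [T]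
    have h2 : b l ∈ T := by simp [T]
    simp only [Function.comp, ext, h1, h2, dite_true]

theorem integrable_and_integral_le_of_lintegral_le {Ω : Type*} [MeasurableSpace Ω] {P : Measure Ω}
    {f : Ω → ℝ} (hf : Measurable f) (h0 : ∀ ω, 0 ≤ f ω) {M : ℝ} (hM : 0 ≤ M)
    (h : ∫⁻ ω, ENNReal.ofReal (f ω) ∂P ≤ ENNReal.ofReal M) :
    Integrable f P ∧ ∫ ω, f ω ∂P ≤ M := by
  constructor
  · refine ⟨hf.aestronglyMeasurable, ?_⟩
    rw [hasFiniteIntegral_iff_ofReal (.of_forall h0)]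
    exact h.trans_lt ENNReal.ofReal_lt_top
  · rw [integral_eq_lintegral_of_nonneg_ae (.of_forall h0) hf.aestronglyMeasurable]
    exact ENNReal.toReal_le_of_le_ofReal hM h

theorem exists_measure_sum_sq_sub_ge_le {ν : ℝ} (hν : 0 < ν) {M : ℝ} (hM : 1 ≤ M) :
    ∃ L : ℝ, 0 ≤ L ∧ ∀ {n p : ℕ} (P : Measure (Fin n × Fin p → ℝ)) [IsProbabilityMeasure P],
      iIndepFun (fun q (z : Fin n × Fin p → ℝ) => z q) P →
      ∀ (R : Finset (Fin p)) (i : Fin n), 0 < R.card →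
      (∀ l ∈ R, ∫⁻ z, ENNReal.ofReal (|z (i, l)| ^ (4 + 2 * ν)) ∂P ≤ ENNReal.ofReal M) →
      ∀ t : ℝ, 0 < t →
      P {z | t * R.card ≤ |∑ l ∈ R, (z (i, l) ^ 2 - ∫ z', z' (i, l) ^ 2 ∂P)|}
        ≤ ENNReal.ofReal (L * (R.card * t ^ 2) ^ (-((2 + ν) / 2))) := by
  -- This constant bounds the moment of order 2 + ν of a centred square; 1 + M bounds its mean.
  have hM' : 1 ≤ 2 ^ (2 + ν) * (M + (1 + M) ^ (2 + ν)) := by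
    have h1 : (1 : ℝ) ≤ 2 ^ (2 + ν) := Real.one_le_rpow one_le_two (by linarith)
    have h2 : (0 : ℝ) ≤ (1 + M) ^ (2 + ν) := by positivity
    nlinarith
  obtain ⟨L, hL, h⟩ := exists_measure_abs_sum_ge_le (q := 2 + ν) (by linarith) hM'
  refine ⟨L, hL, ?_⟩
  intro n p P _ hind R i hR hmom t ht
  have hm : ∀ l, Measurable fun z : Fin n × Fin p → ℝ => z (i, l) := fun l =>
    measurable_pi_apply _
  have key : ∀ l ∈ R, Integrable (fun z : Fin n × Fin p → ℝ => |z (i, l)| ^ (4 + 2 * ν)) P ∧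
      ∫ z, |z (i, l)| ^ (4 + 2 * ν) ∂P ≤ M := fun l hl =>
    integrable_and_integral_le_of_lintegral_le (((hm l).norm).pow_const _)
      (fun z => by positivity) (by linarith) (hmom l hl)
  have hsqle : ∀ x : ℝ, x ^ 2 ≤ 1 + |x| ^ (4 + 2 * ν) := by
    intro x
    rw [← sq_abs]
    have h0 : 0 ≤ |x| ^ (4 + 2 * ν) := by positivity
    rcases le_total |x| 1 with h1 | h1
    · have := pow_le_one₀ (abs_nonneg x) h1 (n := 2)
      linarith
    · have := Real.rpow_le_rpow_of_exponent_le h1 (by linarith : (2 : ℝ) ≤ 4 + 2 * ν)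
      rw [Real.rpow_two] at this
      linarith
  have hsq : ∀ l ∈ R, Integrable (fun z : Fin n × Fin p → ℝ => z (i, l) ^ 2) P := by
    intro l hl
    refine ((integrable_const 1).add (key l hl).1).mono'
      ((hm l).pow_const 2).aestronglyMeasurable (.of_forall fun z => ?_)
    rw [Real.norm_of_nonneg (sq_nonneg _)]
    exact hsqle _
  have hv0 : ∀ l, 0 ≤ ∫ z, z (i, l) ^ 2 ∂P := fun l => integral_nonneg fun z => sq_nonneg _
  have hv : ∀ l ∈ R, ∫ z, z (i, l) ^ 2 ∂P ≤ 1 + M := by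
    intro l hl
    calc ∫ z, z (i, l) ^ 2 ∂P ≤ ∫ z, (1 + |z (i, l)| ^ (4 + 2 * ν)) ∂P :=
          integral_mono (hsq l hl) ((integrable_const 1).add (key l hl).1) fun z => hsqle _
      _ = 1 + ∫ z, |z (i, l)| ^ (4 + 2 * ν) ∂P := by
          rw [integral_add (integrable_const 1) (key l hl).1]; simp
      _ ≤ 1 + M := by linarith [(key l hl).2]
  have hpt : ∀ l ∈ R, ∀ z : Fin n × Fin p → ℝ,
      |z (i, l) ^ 2 - ∫ z', z' (i, l) ^ 2 ∂P| ^ (2 + ν)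
        ≤ 2 ^ (2 + ν) * (|z (i, l)| ^ (4 + 2 * ν) + (1 + M) ^ (2 + ν)) := by
    intro l hl z
    rw [sub_eq_add_neg]
    refine (abs_add_rpow_le_two_rpow (by linarith) _ _).trans ?_
    have e : |z (i, l) ^ 2| ^ (2 + ν) = |z (i, l)| ^ (4 + 2 * ν) := by
      rw [abs_pow, ← Real.rpow_natCast, ← Real.rpow_mul (abs_nonneg _)]
      congr 1; push_cast; ring
    rw [e, abs_neg, abs_of_nonneg (hv0 l)]
    have := Real.rpow_le_rpow (hv0 l) (hv l hl) (by linarith : 0 ≤ 2 + ν)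
    gcongr
  have hdom : ∀ l ∈ R, Integrable (fun z : Fin n × Fin p → ℝ =>
      2 ^ (2 + ν) * (|z (i, l)| ^ (4 + 2 * ν) + (1 + M) ^ (2 + ν))) P := fun l hl =>
    ((key l hl).1.add (integrable_const _)).const_mul _
  have hint : ∀ l ∈ R, Integrable (fun z : Fin n × Fin p → ℝ =>
      |z (i, l) ^ 2 - ∫ z', z' (i, l) ^ 2 ∂P| ^ (2 + ν)) P := by
    intro l hl
    refine (hdom l hl).mono'
      ((((hm l).pow_const 2).sub_const _).norm.pow_const _).aestronglyMeasurable
      (.of_forall fun z => ?_)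
    rw [Real.norm_of_nonneg (by positivity)]
    exact hpt l hl z
  refine h P R (fun l z => z (i, l) ^ 2 - ∫ z', z' (i, l) ^ 2 ∂P)
    (fun l => ((hm l).pow_const 2).sub_const _) hint ?_ ?_ ?_ hR t ht
  · intro l hl
    rw [integral_sub (hsq l hl) (integrable_const _)]
    simp
  · intro l hl
    refine (integral_mono (hint l hl) (hdom l hl) (hpt l hl)).trans ?_
    rw [integral_const_mul, integral_add (key l hl).1 (integrable_const _)]
    simp only [integral_const, probReal_univ, one_smul]
    have := (key l hl).2
    gcongr
  · intro s l hl
    refine indepFun_sum_blocks hind (fun q => measurable_pi_apply q) (a := fun l => (i, l))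
      (b := fun l => (i, l)) ?_ ?_ ?_ (g := fun l x _ => x ^ 2 - ∫ z', z' (i, l) ^ 2 ∂P)
      ?_ s hl
    · intro k l hkl h; exact hkl (Prod.ext_iff.1 h).2
    · intro k l hkl h; exact hkl (Prod.ext_iff.1 h).2
    · intro k l hkl h; exact hkl (Prod.ext_iff.1 h).2
    · intro k
      exact (measurable_fst.pow_const 2).sub_const _

/-- For i ≠ j the factors of z(i,l) z(j,l) are independent, so the product keeps the full order 4 +
2ν. The resulting exponent, twice that for the squares, pays for the n² pairs. -/
theorem exists_measure_sum_cross_ge_le {ν : ℝ} (hν : 0 < ν) {M C : ℝ} (hM : 1 ≤ M) (hC : 0 ≤ C) :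
    ∃ L : ℝ, 0 ≤ L ∧ ∀ {n p : ℕ} (P : Measure (Fin n × Fin p → ℝ)) [IsProbabilityMeasure P],
      iIndepFun (fun q (z : Fin n × Fin p → ℝ) => z q) P →
      ∀ (R : Finset (Fin p)) (i j : Fin n) (c : Fin p → ℝ), i ≠ j → 0 < R.card →
      (∀ l ∈ R, |c l| ≤ C) →
      (∀ i, ∀ l ∈ R, ∫ z, z (i, l) ∂P = 0) →
      (∀ i, ∀ l ∈ R, ∫⁻ z, ENNReal.ofReal (|z (i, l)| ^ (4 + 2 * ν)) ∂P ≤ ENNReal.ofReal M) →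
      ∀ t : ℝ, 0 < t →
      P {z | t * R.card ≤ |∑ l ∈ R, (c l * (z (i, l) - z (j, l)) - 2 * (z (i, l) * z (j, l)))|}
        ≤ ENNReal.ofReal (L * (R.card * t ^ 2) ^ (-(2 + ν))) := by
  set Q := 4 + 2 * ν with hQ
  have hQ0 : 0 ≤ Q := by linarith
  have hM' : 1 ≤ 2 ^ Q * (C ^ Q * (2 ^ Q * (M + M)) + 2 ^ Q * (M * M)) := by
    have h1 : (1 : ℝ) ≤ 2 ^ Q := Real.one_le_rpow one_le_two hQ0
    have h2 : (0 : ℝ) ≤ C ^ Q * (2 ^ Q * (M + M)) := by positivity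
    have h3 : 1 ≤ 2 ^ Q * (M * M) := one_le_mul_of_one_le_of_one_le h1 (by nlinarith)
    nlinarith
  obtain ⟨L, hL, h⟩ := exists_measure_abs_sum_ge_le (q := Q) (by linarith) hM'
  refine ⟨L, hL, ?_⟩
  intro n p P _ hind R i j c hij hR hc hmean hmom t ht
  have hm : ∀ i l, Measurable fun z : Fin n × Fin p → ℝ => z (i, l) := fun i l =>
    measurable_pi_apply _
  have key : ∀ i, ∀ l ∈ R, Integrable (fun z : Fin n × Fin p → ℝ => |z (i, l)| ^ Q) P ∧
      ∫ z, |z (i, l)| ^ Q ∂P ≤ M := fun i l hl =>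
    integrable_and_integral_le_of_lintegral_le (((hm i l).norm).pow_const _)
      (fun z => by positivity) (by linarith) (hmom i l hl)
  have hint1 : ∀ i, ∀ l ∈ R, Integrable (fun z : Fin n × Fin p → ℝ => z (i, l)) P := by
    intro i l hl
    have := integrable_abs_rpow_of_le (zero_le_one) (by linarith : 1 ≤ Q) (hm i l) (key i l hl).1
    simp only [Real.rpow_one] at this
    exact (integrable_norm_iff (hm i l).aestronglyMeasurable).1 this
  have hne : ∀ l : Fin p, (i, l) ≠ (j, l) := fun l h => hij (Prod.ext_iff.1 h).1
  have hIJ : ∀ l, IndepFun (fun z : Fin n × Fin p → ℝ => z (i, l)) (fun z => z (j, l)) P :=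
    fun l => hind.indepFun (hne l)
  have hIJQ : ∀ l, IndepFun (fun z : Fin n × Fin p → ℝ => |z (i, l)| ^ Q)
      (fun z => |z (j, l)| ^ Q) P := fun l =>
    (hIJ l).comp (φ := fun x => |x| ^ Q) (ψ := fun x => |x| ^ Q)
      (measurable_norm.pow_const Q) (measurable_norm.pow_const Q)
  have hprod : ∀ l ∈ R, Integrable (fun z : Fin n × Fin p → ℝ => z (i, l) * z (j, l)) P :=
    fun l hl => (hIJ l).integrable_mul (hint1 i l hl) (hint1 j l hl)
  have hprodQ : ∀ l ∈ R, Integrable (fun z : Fin n × Fin p → ℝ =>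
      |z (i, l)| ^ Q * |z (j, l)| ^ Q) P := fun l hl =>
    (hIJQ l).integrable_mul (key i l hl).1 (key j l hl).1
  have hpt : ∀ l ∈ R, ∀ z : Fin n × Fin p → ℝ,
      |c l * (z (i, l) - z (j, l)) - 2 * (z (i, l) * z (j, l))| ^ Q
        ≤ 2 ^ Q * (C ^ Q * (2 ^ Q * (|z (i, l)| ^ Q + |z (j, l)| ^ Q))
          + 2 ^ Q * (|z (i, l)| ^ Q * |z (j, l)| ^ Q)) := by
    intro l hl z
    rw [sub_eq_add_neg]
    refine (abs_add_rpow_le_two_rpow hQ0 _ _).trans ?_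
    rw [abs_neg, abs_mul, abs_mul 2, abs_mul, abs_two, Real.mul_rpow (abs_nonneg _) (abs_nonneg _),
      Real.mul_rpow zero_le_two (by positivity), Real.mul_rpow (abs_nonneg _) (abs_nonneg _)]
    have h1 := Real.rpow_le_rpow (abs_nonneg _) (hc l hl) hQ0
    have h2 := abs_add_rpow_le_two_rpow hQ0 (z (i, l)) (-z (j, l))
    rw [abs_neg, ← sub_eq_add_neg] at h2
    gcongr
  have hdom1 : ∀ l ∈ R, Integrable (fun z : Fin n × Fin p → ℝ =>
      C ^ Q * (2 ^ Q * (|z (i, l)| ^ Q + |z (j, l)| ^ Q))) P := fun l hl =>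
    (((key i l hl).1.add (key j l hl).1).const_mul _).const_mul _
  have hdom2 : ∀ l ∈ R, Integrable (fun z : Fin n × Fin p → ℝ =>
      2 ^ Q * (|z (i, l)| ^ Q * |z (j, l)| ^ Q)) P := fun l hl => (hprodQ l hl).const_mul _
  have hdom : ∀ l ∈ R, Integrable (fun z : Fin n × Fin p → ℝ =>
      2 ^ Q * (C ^ Q * (2 ^ Q * (|z (i, l)| ^ Q + |z (j, l)| ^ Q))
          + 2 ^ Q * (|z (i, l)| ^ Q * |z (j, l)| ^ Q))) P := fun l hl =>
    ((hdom1 l hl).add (hdom2 l hl)).const_mul _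
  have hYm : ∀ l, Measurable fun z : Fin n × Fin p → ℝ =>
      c l * (z (i, l) - z (j, l)) - 2 * (z (i, l) * z (j, l)) := fun l => by fun_prop
  have hint : ∀ l ∈ R, Integrable (fun z : Fin n × Fin p → ℝ =>
      |c l * (z (i, l) - z (j, l)) - 2 * (z (i, l) * z (j, l))| ^ Q) P := by
    intro l hl
    refine (hdom l hl).mono' ((hYm l).norm.pow_const _).aestronglyMeasurable
      (.of_forall fun z => ?_)
    rw [Real.norm_of_nonneg (by positivity)]
    exact hpt l hl z
  have := h P R (fun l z => c l * (z (i, l) - z (j, l)) - 2 * (z (i, l) * z (j, l)))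
    hYm hint ?_ ?_ ?_ hR t ht
  · rwa [show Q / 2 = 2 + ν by rw [hQ]; ring] at this
  · intro l hl
    have J1 := ((hint1 i l hl).sub (hint1 j l hl)).const_mul (c l)
    simp only [Pi.sub_def] at J1
    rw [integral_sub J1 ((hprod l hl).const_mul _),
      integral_const_mul, integral_const_mul, integral_sub (hint1 i l hl) (hint1 j l hl),
      (hIJ l).integral_fun_mul_eq_mul_integral (hm i l).aestronglyMeasurable
        (hm j l).aestronglyMeasurable, hmean i l hl, hmean j l hl]
    simp
  · intro l hl
    refine (integral_mono (hint l hl) (hdom l hl) (hpt l hl)).trans ?_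
    rw [integral_const_mul, integral_add (hdom1 l hl) (hdom2 l hl), integral_const_mul,
      integral_const_mul, integral_const_mul, integral_add (key i l hl).1 (key j l hl).1,
      (hIJQ l).integral_fun_mul_eq_mul_integral (key i l hl).1.aestronglyMeasurable
        (key j l hl).1.aestronglyMeasurable]
    have h1 := (key i l hl).2
    have h2 := (key j l hl).2
    have h3 : 0 ≤ ∫ z, |z (j, l)| ^ Q ∂P := integral_nonneg fun z => by positivity
    gcongr
  · intro s l hl
    refine indepFun_sum_blocks hind (fun q => measurable_pi_apply q) (a := fun l => (i, l))
      (b := fun l => (j, l)) ?_ ?_ ?_ (g := fun l x y => c l * (x - y) - 2 * (x * y)) ?_ s hl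
    · intro k l hkl h; exact hkl (Prod.ext_iff.1 h).2
    · intro k l hkl h; exact hkl (Prod.ext_iff.1 h).2
    · intro k l hkl h; exact hkl (Prod.ext_iff.1 h).2
    · intro k
      simp only [Function.uncurry_def]
      fun_prop

/-! ### Regular conditional laws. -/

section CondLaw

variable {Ω β : Type*} [mΩ : MeasurableSpace Ω] [mβ : MeasurableSpace β] {μ : Measure Ω}
  [IsProbabilityMeasure μ] {X : Ω → β}

theorem lintegral_prodMk_eq_lintegral_condDistrib {γ : Type*} [MeasurableSpace γ]
    [StandardBorelSpace γ] [Nonempty γ] {Y : Ω → γ} (hX : Measurable X) (hY : Measurable Y)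
    {f : β × γ → ℝ≥0∞} (hf : Measurable f) :
    ∫⁻ ω, f (X ω, Y ω) ∂μ = ∫⁻ ω, ∫⁻ y, f (X ω, y) ∂condDistrib Y X μ (X ω) ∂μ := by
  rw [← lintegral_map (f := f) (g := fun ω => (X ω, Y ω)) hf (hX.prodMk hY),
    ← compProd_map_condDistrib hY.aemeasurable, Measure.lintegral_compProd hf,
    lintegral_map (hf.lintegral_kernel_prod_right') hX]

theorem condLExp_ae_eq_lintegral_condDistrib {γ : Type*} [MeasurableSpace γ]
    [StandardBorelSpace γ] [Nonempty γ] {Y : Ω → γ} (hX : Measurable X) (hY : Measurable Y)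
    {g : γ → ℝ≥0∞} (hg : Measurable g) :
    condLExp (mβ.comap X) μ (fun ω => g (Y ω))
      =ᵐ[μ] fun ω => ∫⁻ y, g y ∂condDistrib Y X μ (X ω) := by
  symm
  have hmeas : Measurable fun x => ∫⁻ y, g y ∂condDistrib Y X μ x := hg.lintegral_kernel
  refine ae_eq_condLExp hX.comap_le μ _ (hmeas.comp (comap_measurable X)) ?_
  rintro _ ⟨t, ht, rfl⟩
  have h := lintegral_prodMk_eq_lintegral_condDistrib (μ := μ) hX hY
    (f := fun z => t.indicator 1 z.1 * g z.2)
    (((measurable_one.indicator ht).comp measurable_fst).mul (hg.comp measurable_snd))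
  have e : ∀ x : β, ∫⁻ y, t.indicator 1 x * g y ∂condDistrib Y X μ x
      = t.indicator 1 x * ∫⁻ y, g y ∂condDistrib Y X μ x := fun x => lintegral_const_mul _ hg
  simp only [e] at h
  rw [← lintegral_indicator (hX ht), ← lintegral_indicator (hX ht)]
  convert h.symm using 1 <;>
  · refine lintegral_congr fun ω => ?_
    by_cases hω : X ω ∈ t
    · simp [Set.indicator, hω]
    · simp [Set.indicator, hω]

/-- Integrates a conditional bound valid on an event of the conditioning variable; B may depend on
that variable, as the coefficients of the cross terms do. -/
theorem measure_inter_le_of_condDistrib_le {γ : Type*} [MeasurableSpace γ]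
    [StandardBorelSpace γ] [Nonempty γ] {Y : Ω → γ} (hX : Measurable X) (hY : Measurable Y)
    {G : Set β} (hG : MeasurableSet G) {B : Set (β × γ)} (hB : MeasurableSet B) {c : ℝ≥0∞}
    (h : ∀ᵐ ω ∂μ, X ω ∈ G → condDistrib Y X μ (X ω) {y | (X ω, y) ∈ B} ≤ c) :
    μ {ω | X ω ∈ G ∧ (X ω, Y ω) ∈ B} ≤ c := by
  have hGB : MeasurableSet ((Prod.fst ⁻¹' G) ∩ B : Set (β × γ)) := (measurable_fst hG).inter hB
  have h1 := lintegral_prodMk_eq_lintegral_condDistrib (μ := μ) hX hY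
    (f := ((Prod.fst ⁻¹' G) ∩ B).indicator 1) (measurable_one.indicator hGB)
  have e1 : ∫⁻ ω, ((Prod.fst ⁻¹' G) ∩ B).indicator (1 : β × γ → ℝ≥0∞) (X ω, Y ω) ∂μ
      = μ {ω | X ω ∈ G ∧ (X ω, Y ω) ∈ B} :=
    lintegral_indicator_one ((hX.prodMk hY) hGB)
  rw [← e1, h1]
  calc _ ≤ ∫⁻ _, c ∂μ := by
        refine lintegral_mono_ae ?_
        filter_upwards [h] with ω hω
        by_cases hg : X ω ∈ G
        · refine le_trans (le_of_eq ?_) (hω hg)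
          refine Eq.trans (lintegral_congr fun y => ?_)
            (lintegral_indicator_one (measurable_prodMk_left (x := X ω) hB))
          by_cases hb : (X ω, y) ∈ B
          · have m1 : (X ω, y) ∈ Prod.fst ⁻¹' G ∩ B := ⟨hg, hb⟩
            have m2 : y ∈ {y | (X ω, y) ∈ B} := hb
            rw [Set.indicator_of_mem m1, Set.indicator_of_mem m2]
            rfl
          · have m1 : (X ω, y) ∉ Prod.fst ⁻¹' G ∩ B := fun h => hb h.2
            have m2 : y ∉ {y | (X ω, y) ∈ B} := hb
            rw [Set.indicator_of_notMem m1, Set.indicator_of_notMem m2]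
        · simp [Set.indicator, hg]
    _ = c := by simp

/-- Each factorization holds only off a null set depending on the sets chosen. Half-lines with
rational endpoints form a countable generating π-system, so a single null set suffices. -/
theorem ae_iIndepFun_condDistrib {ι : Type*} [Finite ι] {Z : ι → Ω → ℝ}
    (hX : Measurable X) (hZ : ∀ i, Measurable (Z i))
    (h : NonlinearFactor.CondIndepFamily (mβ.comap X) μ Z) :
    ∀ᵐ ω ∂μ, iIndepFun (fun i (z : ι → ℝ) => z i)
      (condDistrib (fun ω i => Z i ω) X μ (X ω)) := by
  have hY : Measurable fun ω i => Z i ω := measurable_pi_lambda _ hZ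
  set κ := condDistrib (fun ω i => Z i ω) X μ
  have key : ∀ᵐ ω ∂μ, ∀ (s : Finset ι) (q : ι → ℚ),
      κ (X ω) (⋂ i ∈ s, (fun z => z i) ⁻¹' Set.Iic (q i : ℝ))
        = ∏ i ∈ s, κ (X ω) ((fun z => z i) ⁻¹' Set.Iic (q i : ℝ)) := by
    have := Fintype.ofFinite ι
    rw [ae_all_iff]; intro s
    rw [ae_all_iff]; intro q
    have hS : ∀ i, MeasurableSet ((fun z : ι → ℝ => z i) ⁻¹' Set.Iic (q i : ℝ)) := fun i =>
      measurable_pi_apply i measurableSet_Iic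
    have h1 := condDistrib_ae_eq_condExp (μ := μ) hX hY
      (s := ⋂ i ∈ s, (fun z : ι → ℝ => z i) ⁻¹' Set.Iic (q i : ℝ))
      (Finset.measurableSet_biInter s fun i _ => hS i)
    have h2 : ∀ᵐ ω ∂μ, ∀ i, (κ (X ω)).real ((fun z : ι → ℝ => z i) ⁻¹' Set.Iic (q i : ℝ))
        = (μ⟦Z i ⁻¹' Set.Iic (q i : ℝ)|mβ.comap X⟧) ω :=
      ae_all_iff.2 fun i => condDistrib_ae_eq_condExp (μ := μ) hX hY (hS i)
    have h3 := h s (fun i => Set.Iic (q i : ℝ)) fun i _ => measurableSet_Iic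
    have e : (fun ω i => Z i ω) ⁻¹' (⋂ i ∈ s, (fun z : ι → ℝ => z i) ⁻¹' Set.Iic (q i : ℝ))
        = ⋂ i ∈ s, Z i ⁻¹' Set.Iic (q i : ℝ) := by
      ext ω; simp
    rw [e] at h1
    filter_upwards [h1, h2, h3] with ω h1 h2 h3
    rw [h3, Finset.prod_apply] at h1
    have h4 : (κ (X ω)).real (⋂ i ∈ s, (fun z : ι → ℝ => z i) ⁻¹' Set.Iic (q i : ℝ))
        = ∏ i ∈ s, (κ (X ω)).real ((fun z : ι → ℝ => z i) ⁻¹' Set.Iic (q i : ℝ)) :=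
      h1.trans (Finset.prod_congr rfl fun i _ => (h2 i).symm)
    simp only [measureReal_def] at h4
    rw [← ENNReal.toReal_prod] at h4
    exact (ENNReal.toReal_eq_toReal_iff' (measure_ne_top _ _)
      (ENNReal.prod_ne_top fun i _ => measure_ne_top _ _)).1 h4
  filter_upwards [key] with ω hω
  rw [iIndepFun_iff_iIndep]
  refine iIndepSets.iIndep (fun i => (measurable_pi_apply i).comap_le)
    (fun i => {s | ∃ t ∈ ⋃ a : ℚ, {Set.Iic (a : ℝ)}, (fun z : ι → ℝ => z i) ⁻¹' t = s})
    (fun i => Real.isPiSystem_Iic_rat.comap _) (fun i => ?_) ?_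
  · rw [BorelSpace.measurable_eq (α := ℝ), Real.borel_eq_generateFrom_Iic_rat,
      MeasurableSpace.comap_generateFrom]
    rfl
  · rw [iIndepSets_iff]
    intro s f hf
    have : ∀ i, ∃ a : ℚ, i ∈ s → f i = (fun z : ι → ℝ => z i) ⁻¹' Set.Iic (a : ℝ) := by
      intro i
      by_cases hi : i ∈ s
      · obtain ⟨t, ht, hte⟩ := hf i hi
        simp only [Set.mem_iUnion, Set.mem_singleton_iff] at ht
        obtain ⟨a, rfl⟩ := ht
        exact ⟨a, fun _ => hte.symm⟩
      · exact ⟨0, fun h => absurd h hi⟩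
    choose a ha using this
    rw [Finset.prod_congr rfl fun i hi => by rw [ha i hi], ← hω s a]
    congr 1
    exact Set.iInter₂_congr ha

end CondLaw

/-! ### Calculus on a convex set. -/

section Calculus

variable {r : ℕ}

theorem opNorm_le_of_apply_single_le {F : Type*} [NormedAddCommGroup F] [NormedSpace ℝ F]
    (T : EuclideanSpace ℝ (Fin r) →L[ℝ] F) {B : ℝ} (hB : 0 ≤ B)
    (h : ∀ k, ‖T (EuclideanSpace.single k 1)‖ ≤ B) : ‖T‖ ≤ r * B := by
  refine T.opNorm_le_bound (by positivity) fun v => ?_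
  have e : v = ∑ k, v k • EuclideanSpace.single k (1 : ℝ) := by
    have := (EuclideanSpace.basisFun (Fin r) ℝ).sum_repr v
    simpa using this.symm
  conv_lhs => rw [e, map_sum]
  refine (norm_sum_le _ _).trans ?_
  calc ∑ k, ‖T (v k • EuclideanSpace.single k (1 : ℝ))‖ ≤ ∑ _k : Fin r, ‖v‖ * B := by
        refine Finset.sum_le_sum fun k _ => ?_
        rw [map_smul, norm_smul]
        exact mul_le_mul (PiLp.norm_apply_le v k) (h k) (norm_nonneg _) (norm_nonneg _)
    _ = r * B * ‖v‖ := by simp; ring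

variable {A : Set (EuclideanSpace ℝ (Fin r))} {f : EuclideanSpace ℝ (Fin r) → ℝ} {m : ℕ} {C : ℝ}

/-- All partial derivatives of `f` of order at most `m` are bounded by `C` on `A`. -/
def PartialsBounded (m : ℕ) (C : ℝ) (A : Set (EuclideanSpace ℝ (Fin r)))
    (f : EuclideanSpace ℝ (Fin r) → ℝ) : Prop :=
  ∀ k ≤ m, ∀ d : Fin k → Fin r, ∀ x ∈ A,
    |iteratedFDerivWithin ℝ k f A x fun s => EuclideanSpace.single (d s) 1| ≤ C

theorem PartialsBounded.abs_le (h : PartialsBounded m C A f) {x : EuclideanSpace ℝ (Fin r)}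
    (hx : x ∈ A) : |f x| ≤ C := by
  have := h 0 (Nat.zero_le _) Fin.elim0 x hx
  rwa [iteratedFDerivWithin_zero_apply] at this

theorem PartialsBounded.norm_fderivWithin_le (h : PartialsBounded m C A f) (hm : 2 ≤ m)
    (hA : UniqueDiffOn ℝ A) {x : EuclideanSpace ℝ (Fin r)} (hx : x ∈ A) :
    ‖fderivWithin ℝ f A x‖ ≤ r * C := by
  refine opNorm_le_of_apply_single_le _ ((abs_nonneg _).trans (h.abs_le hx)) fun k => ?_
  have := h 1 (by omega) (fun _ => k) x hx
  rwa [iteratedFDerivWithin_one_apply (hA x hx)] at this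

theorem PartialsBounded.norm_fderivWithin_fderivWithin_le (h : PartialsBounded m C A f)
    (hm : 2 ≤ m) (hA : UniqueDiffOn ℝ A) {x : EuclideanSpace ℝ (Fin r)} (hx : x ∈ A) :
    ‖fderivWithin ℝ (fderivWithin ℝ f A) A x‖ ≤ r * (r * C) := by
  have hC : 0 ≤ C := (abs_nonneg _).trans (h.abs_le hx)
  refine opNorm_le_of_apply_single_le _ (by positivity) fun k => ?_
  refine opNorm_le_of_apply_single_le _ hC fun l => ?_
  have := h 2 hm ![k, l] x hx
  rwa [iteratedFDerivWithin_two_apply f hA hx] at this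

theorem PartialsBounded.abs_sub_le (h : PartialsBounded m C A f) (hm : 2 ≤ m)
    (hA : UniqueDiffOn ℝ A) (hc : Convex ℝ A) (hf : ContDiffOn ℝ m f A)
    {x y : EuclideanSpace ℝ (Fin r)} (hx : x ∈ A) (hy : y ∈ A) :
    |f y - f x| ≤ r * C * ‖y - x‖ :=
  hc.norm_image_sub_le_of_norm_fderivWithin_le
    (hf.differentiableOn (by norm_cast; omega)) (fun _ hz => h.norm_fderivWithin_le hm hA hz) hx hy

theorem PartialsBounded.abs_sub_sub_le (h : PartialsBounded m C A f) (hm : 2 ≤ m)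
    (hA : UniqueDiffOn ℝ A) (hc : Convex ℝ A) (hf : ContDiffOn ℝ m f A)
    {x y : EuclideanSpace ℝ (Fin r)} (hx : x ∈ A) (hy : y ∈ A) :
    |f y - f x - fderivWithin ℝ f A x (y - x)| ≤ r * (r * C) * ‖y - x‖ ^ 2 := by
  have hC : 0 ≤ C := (abs_nonneg _).trans (h.abs_le hx)
  have hd : DifferentiableOn ℝ (fderivWithin ℝ f A) A :=
    (hf.fderivWithin hA (m := 1) (by norm_cast)).differentiableOn (by simp)
  have hlip : ∀ z ∈ A, ‖fderivWithin ℝ f A z - fderivWithin ℝ f A x‖ ≤ r * (r * C) * ‖z - x‖ :=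
    fun z hz => hc.norm_image_sub_le_of_norm_fderivWithin_le hd
      (fun _ hw => h.norm_fderivWithin_fderivWithin_le hm hA hw) hx hz
  have hfd : DifferentiableOn ℝ f A := hf.differentiableOn (by norm_cast; omega)
  -- Restricting to the ball of radius ‖y - x‖ turns the Lipschitz bound on the derivative into a
  -- uniform one.
  have key := (hc.inter (convex_closedBall x ‖y - x‖)).norm_image_sub_le_of_norm_hasFDerivWithin_le'
    (f := f) (f' := fderivWithin ℝ f A) (φ := fderivWithin ℝ f A x)
    (C := r * (r * C) * ‖y - x‖) (x := x) (y := y)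
    (fun z hz => ((hfd z hz.1).hasFDerivWithinAt).mono Set.inter_subset_left)
    (fun z hz => (hlip z hz.1).trans (by
      have := mem_closedBall_iff_norm.1 hz.2
      gcongr))
    ⟨hx, Metric.mem_closedBall_self (norm_nonneg _)⟩ ⟨hy, mem_closedBall_iff_norm.2 le_rfl⟩
  rw [pow_two, ← mul_assoc]
  exact key

end Calculus

/-! ### The smallest singular value as a lower bound for a quadratic form. -/

section SingularValues

open NonlinearFactor

/-- For a positive semidefinite matrix each eigenvalue is itself a singular value, because its
square is an eigenvalue of T*T. Hence no eigenvalue lies below `sMin`, and the form is diagonalized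
in an eigenbasis. -/
theorem sMin_mul_norm_sq_le {r : ℕ} {M : Matrix (Fin r) (Fin r) ℝ} (hM : M.PosSemidef)
    (v : EuclideanSpace ℝ (Fin r)) :
    sMin M * ‖v‖ ^ 2 ≤ inner ℝ v (Matrix.toEuclideanLin M v) := by
  set T := Matrix.toEuclideanLin M with hT
  have hsym : T.IsSymmetric := Matrix.isSymmetric_toEuclideanLin_iff.2 hM.1
  have hr : Module.finrank ℝ (EuclideanSpace ℝ (Fin r)) = r := by simp
  have hadj : LinearMap.adjoint T = T := (LinearMap.isSymmetric_iff_isSelfAdjoint T).1 hsym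
  let b := hsym.eigenvectorBasis hr
  have hb : ∀ k, T (b k) = hsym.eigenvalues hr k • b k := fun k =>
    hsym.apply_eigenvectorBasis hr k
  have hinn : ∀ x, 0 ≤ inner ℝ x (T x) := by
    intro x
    have := hM.dotProduct_mulVec_nonneg x.ofLp
    rw [EuclideanSpace.inner_eq_star_dotProduct]
    simpa [T, dotProduct_comm] using this
  have hpos : ∀ k, 0 ≤ hsym.eigenvalues hr k := by
    intro k
    have := hinn (b k)
    rw [hb, inner_smul_right, real_inner_self_eq_norm_sq, b.orthonormal.1 k] at this
    simpa using this
  have hle : ∀ k, sMin M ≤ hsym.eigenvalues hr k := by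
    intro k
    have h1 : Module.End.HasEigenvalue (LinearMap.adjoint T ∘ₗ T)
        ((hsym.eigenvalues hr k) ^ 2 : ℝ) := by
      refine Module.End.hasEigenvalue_of_hasEigenvector (x := b k) ⟨?_, b.orthonormal.ne_zero k⟩
      rw [Module.End.mem_eigenspace_iff, LinearMap.comp_apply, hadj, hb, map_smul, hb, smul_smul,
        pow_two]
    obtain ⟨i, hi⟩ := T.isSymmetric_adjoint_comp_self.exists_eigenvalues_eq hr h1
    rw [← T.sq_singularValues_fin hr i] at hi
    have h2 : T.singularValues i = hsym.eigenvalues hr k :=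
      (pow_left_inj₀ (T.singularValues_nonneg _) (hpos k) two_ne_zero).1 (by exact_mod_cast hi)
    rw [← h2]
    exact T.singularValues_antitone (by have := i.2; omega)
  have e1 : inner ℝ v (T v) = ∑ k, hsym.eigenvalues hr k * inner ℝ (b k) v ^ 2 := by
    rw [← b.sum_inner_mul_inner v (T v)]
    refine Finset.sum_congr rfl fun k _ => ?_
    rw [← hsym (b k) v, hb, inner_smul_left, real_inner_comm v (b k)]
    simp; ring
  have e2 : ‖v‖ ^ 2 = ∑ k, inner ℝ (b k) v ^ 2 := by
    rw [← real_inner_self_eq_norm_sq, ← b.sum_inner_mul_inner v v]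
    refine Finset.sum_congr rfl fun k _ => ?_
    rw [real_inner_comm v (b k), pow_two]
  rw [e1, e2, Finset.mul_sum]
  exact Finset.sum_le_sum fun k _ => mul_le_mul_of_nonneg_right (hle k) (sq_nonneg _)

end SingularValues

/-! ### Deterministic comparison of the distance of H-columns with the latent distance. -/

namespace NonlinearFactor

theorem sqDist_eq_sum {ι : Type*} [Fintype ι] (v w : EuclideanSpace ℝ ι) :
    sqDist v w = (∑ l, (v l - w l) ^ 2) / (Fintype.card ι : ℝ) := by
  rw [sqDist, EuclideanSpace.real_norm_sq_eq]
  rfl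

theorem sqDist_comm {ι : Type*} [Fintype ι] (v w : EuclideanSpace ℝ ι) :
    sqDist v w = sqDist w v := by
  rw [sqDist, sqDist, norm_sub_rev]

namespace Sample

variable {r n p : ℕ} {Ω : Type*} [mΩ : MeasurableSpace Ω] (S : Sample r n p Ω)
  {A : Set (EuclideanSpace ℝ (Fin r))} {m : ℕ} {C : ℝ} (R : Finset (Fin p)) {ω : Ω} {i j : Fin n}

theorem sqDist_colH : sqDist (S.colH R i ω) (S.colH R j ω)
    = (∑ l ∈ R, (S.η l ω (S.α i ω) - S.η l ω (S.α j ω)) ^ 2) / (R.card : ℝ) := by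
  rw [sqDist_eq_sum, Fintype.card_coe, ← Finset.sum_coe_sort R]
  rfl

theorem sqDist_colH_le (hm : 2 ≤ m) (hA : UniqueDiffOn ℝ A) (hc : Convex ℝ A)
    (hf : ∀ l, ContDiffOn ℝ m (S.η l ω) A) (hb : ∀ l, PartialsBounded m C A (S.η l ω))
    (hi : S.α i ω ∈ A) (hj : S.α j ω ∈ A) :
    sqDist (S.colH R i ω) (S.colH R j ω) ≤ (r * C) ^ 2 * ‖S.α i ω - S.α j ω‖ ^ 2 := by
  rw [sqDist_colH]
  refine div_le_of_le_mul₀ (by positivity) (by positivity) ?_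
  calc ∑ l ∈ R, (S.η l ω (S.α i ω) - S.η l ω (S.α j ω)) ^ 2
      ≤ ∑ _l ∈ R, (r * C * ‖S.α i ω - S.α j ω‖) ^ 2 := by
        refine Finset.sum_le_sum fun l _ => ?_
        rw [← sq_abs]
        have := (hb l).abs_sub_le hm hA hc (hf l) hj hi
        gcongr
    _ = _ := by rw [Finset.sum_const, nsmul_eq_mul]; ring

theorem posSemidef_gram (x : EuclideanSpace ℝ (Fin r)) : (S.gram A R ω x).PosSemidef := by
  refine Matrix.PosSemidef.smul ?_ (by positivity)
  have := Matrix.posSemidef_conjTranspose_mul_self (S.jacobian A R ω x)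
  rwa [Matrix.conjTranspose_eq_transpose_of_trivial] at this

theorem inner_gram (x v : EuclideanSpace ℝ (Fin r)) :
    inner ℝ v (Matrix.toEuclideanLin (S.gram A R ω x) v)
      = (∑ l ∈ R, (fderivWithin ℝ (S.η l ω) A x v) ^ 2) / (R.card : ℝ) := by
  have hJ : ∀ l : R, ((S.jacobian A R ω x).mulVec v.ofLp) l = fderivWithin ℝ (S.η l ω) A x v := by
    intro l
    have e : v = ∑ k, v k • EuclideanSpace.single k (1 : ℝ) := by
      have := (EuclideanSpace.basisFun (Fin r) ℝ).sum_repr v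
      simpa using this.symm
    conv_rhs => rw [e, map_sum]
    simp only [Matrix.mulVec, dotProduct, jacobian, Matrix.of_apply, map_smul, smul_eq_mul]
    exact Finset.sum_congr rfl fun k _ => mul_comm _ _
  have e : (Matrix.toEuclideanLin (S.gram A R ω x) v).ofLp = (S.gram A R ω x).mulVec v.ofLp := rfl
  rw [EuclideanSpace.inner_eq_star_dotProduct, e, dotProduct_comm, star_trivial, gram,
    Matrix.smul_mulVec, dotProduct_smul, ← Matrix.mulVec_mulVec, Matrix.dotProduct_mulVec,
    Matrix.vecMul_transpose]
  rw [dotProduct, ← Finset.sum_coe_sort R, smul_eq_mul, div_mul_eq_mul_div, one_mul]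
  simp only [hJ, pow_two]

/-- The Gram matrix bounds the linearized distance below by c‖d‖². Half of it survives the passage
to the increments, and the smallness of d lets the Taylor remainder consume at most another quarter.
-/
theorem le_sqDist_colH (hm : 2 ≤ m) (hA : UniqueDiffOn ℝ A) (hc : Convex ℝ A)
    (hf : ∀ l, ContDiffOn ℝ m (S.η l ω) A) (hb : ∀ l, PartialsBounded m C A (S.η l ω))
    (hi : S.α i ω ∈ A) (hj : S.α j ω ∈ A) (hR : 0 < R.card) {c : ℝ}
    (hs : c ≤ sMin (S.gram A R ω (S.α i ω)))
    (hd : (r * (r * C)) ^ 2 * ‖S.α i ω - S.α j ω‖ ^ 2 ≤ c / 4) :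
    c / 4 * ‖S.α i ω - S.α j ω‖ ^ 2 ≤ sqDist (S.colH R i ω) (S.colH R j ω) := by
  rw [norm_sub_rev] at hd ⊢
  rw [sqDist_comm, sqDist_colH]
  set d := S.α j ω - S.α i ω
  have h1 := (mul_le_mul_of_nonneg_right hs (sq_nonneg ‖d‖)).trans
    (sMin_mul_norm_sq_le (S.posSemidef_gram R (ω := ω) (S.α i ω)) d)
  rw [inner_gram] at h1
  have hD : (0 : ℝ) < R.card := by exact_mod_cast hR
  rw [le_div_iff₀ hD] at h1 ⊢
  -- With increment x and linear part y, x² + (x - y)² ≥ y²/2, and |x - y| is the Taylor remainder.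
  have h2 : ∀ l ∈ R, (fderivWithin ℝ (S.η l ω) A (S.α i ω) d) ^ 2 / 2
      - (r * (r * C)) ^ 2 * ‖d‖ ^ 2 * ‖d‖ ^ 2
      ≤ (S.η l ω (S.α j ω) - S.η l ω (S.α i ω)) ^ 2 := by
    intro l _
    have h3 := (hb l).abs_sub_sub_le hm hA hc (hf l) hi hj
    have h4 := pow_le_pow_left₀ (abs_nonneg _) h3 2
    rw [sq_abs] at h4
    have e : (r * (r * C) * ‖d‖ ^ 2) ^ 2 = (r * (r * C)) ^ 2 * ‖d‖ ^ 2 * ‖d‖ ^ 2 := by ring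
    rw [e] at h4
    nlinarith [sq_nonneg (2 * (S.η l ω (S.α j ω) - S.η l ω (S.α i ω))
      - fderivWithin ℝ (S.η l ω) A (S.α i ω) d)]
  have h3 := Finset.sum_le_sum h2
  rw [Finset.sum_sub_distrib, ← Finset.sum_div, Finset.sum_const, nsmul_eq_mul] at h3
  have h5 : (r * (r * C)) ^ 2 * ‖d‖ ^ 2 * ‖d‖ ^ 2 ≤ c / 4 * ‖d‖ ^ 2 :=
    mul_le_mul_of_nonneg_right hd (sq_nonneg _)
  nlinarith [mul_le_mul_of_nonneg_left h5 hD.le]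

end Sample

end NonlinearFactor

/-! ### Stochastic order, support of the latent variables, and conditioning on the latent field. -/

namespace NonlinearFactor

section Stochastic

variable {Ω : ℕ → Type*} [∀ n, MeasurableSpace (Ω n)] {μ : ∀ n, Measure (Ω n)}

theorem bigOP_of_forall {Y b : ∀ n, Ω n → ℝ}
    (h : ∀ δ : ℝ≥0∞, 0 < δ → ∃ ε₀ : ℝ, ∀ ε ≥ ε₀, ∀ᶠ n in atTop,
      μ n {ω | ε * |b n ω| ≤ |Y n ω|} ≤ δ) : BigOP μ Y b := by
  refine le_antisymm (le_of_forall_gt_imp_ge_of_dense fun δ hδ => ?_) bot_le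
  obtain ⟨ε₀, hε⟩ := h δ hδ
  refine limsup_le_of_le (by isBoundedDefault) ?_
  filter_upwards [eventually_ge_atTop ε₀] with ε hε'
  exact limsup_le_of_le (by isBoundedDefault) (hε ε hε')

theorem StochBounded.exists_eventually_le {Y : ∀ n, Ω n → ℝ≥0∞} (h : StochBounded μ Y)
    {δ : ℝ≥0∞} (hδ : 0 < δ) :
    ∃ M : ℝ, 1 ≤ M ∧ ∀ᶠ n in atTop, μ n {ω | ENNReal.ofReal M ≤ Y n ω} ≤ δ := by
  have h1 := eventually_lt_of_limsup_lt (h.trans_lt hδ)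
  obtain ⟨M, hM, hM1⟩ := (h1.and (eventually_ge_atTop 1)).exists
  exact ⟨M, hM1, (eventually_lt_of_limsup_lt hM).mono fun n hn => hn.le⟩

end Stochastic

namespace Regularities

variable {r : ℕ} {p : ℕ → ℕ} {Ω : ℕ → Type*} [∀ n, MeasurableSpace (Ω n)]
  {μ : ∀ n, Measure (Ω n)}
  {S : ∀ n, Sample r n (p n) (Ω n)} {A : Set (EuclideanSpace ℝ (Fin r))} {m : ℕ} {ν : ℝ}

theorem map_α_absolutelyContinuous (h : Regularities μ S A m ν) {n : ℕ} (i : Fin n) :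
    (μ n).map ((S n).α i) ≪ volume.restrict A := by
  obtain ⟨c, C, _, hd⟩ := h.density_α
  obtain ⟨f, _, _, hf⟩ := hd n
  rw [hf i]
  exact withDensity_absolutelyContinuous _ _

theorem exists_ae_partialsBounded (h : Regularities μ S A m ν) :
    ∃ C : ℝ, 0 ≤ C ∧ ∀ n, ∀ᵐ ω ∂μ n, ∀ l, PartialsBounded m C A ((S n).η l ω) := by
  obtain ⟨C, hC⟩ := h.bounded
  refine ⟨max C 0, le_max_right _ _, fun n => (hC n).mono fun ω hω l k hk d x hx => ?_⟩
  exact (hω l k hk d x hx).trans (le_max_left _ _)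

theorem ae_α_mem (h : Regularities μ S A m ν) {n : ℕ} (i : Fin n) :
    ∀ᵐ ω ∂μ n, (S n).α i ω ∈ A := by
  have hA : MeasurableSet A := h.isCompact.isClosed.measurableSet
  refine ae_of_ae_map ((S n).measurable_α i).aemeasurable ?_
  exact (h.map_α_absolutelyContinuous i).ae_le (ae_restrict_mem hA)

variable [∀ n, IsProbabilityMeasure (μ n)]

/-- A convex set with empty interior lies in its own null frontier and cannot carry an absolutely
continuous probability law. Nonempty interior makes derivatives within A unique. -/
theorem interior_nonempty (h : Regularities μ S A m ν) : (interior A).Nonempty := by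
  by_contra hne
  rw [Set.not_nonempty_iff_eq_empty] at hne
  have hvol : volume A = 0 := by
    refine measure_mono_null ?_ (h.convex.addHaar_frontier volume)
    rw [frontier, hne, Set.sdiff_empty]
    exact subset_closure
  have h1 := h.map_α_absolutelyContinuous (n := 1) 0
  rw [Measure.restrict_eq_zero.2 hvol, Measure.absolutelyContinuous_zero_iff,
    Measure.map_eq_zero_iff ((S 1).measurable_α 0).aemeasurable] at h1
  exact IsProbabilityMeasure.ne_zero (μ 1) h1

theorem uniqueDiffOn (h : Regularities μ S A m ν) : UniqueDiffOn ℝ A :=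
  uniqueDiffOn_convex h.convex h.interior_nonempty

/-- By independence the joint law is a product with an atomless factor, which does not charge the
diagonal. -/
theorem ae_α_ne (h : Regularities μ S A m ν) (hr : 0 < r) {n : ℕ} {i j : Fin n} (hij : i ≠ j) :
    ∀ᵐ ω ∂μ n, (S n).α i ω ≠ (S n).α j ω := by
  have : Nonempty (Fin r) := ⟨⟨0, hr⟩⟩
  have hac : (μ n).map ((S n).α j) ≪ volume :=
    (h.map_α_absolutelyContinuous j).trans Measure.restrict_le_self.absolutelyContinuous
  have hi := (S n).measurable_α i
  have hj := (S n).measurable_α j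
  have hind := (h.indep_α n).indepFun hij
  rw [indepFun_iff_map_prod_eq_prod_map_map hi.aemeasurable hj.aemeasurable] at hind
  have hdiag : MeasurableSet (Set.diagonal (EuclideanSpace ℝ (Fin r))) := measurableSet_diagonal
  have : IsProbabilityMeasure ((μ n).map ((S n).α j)) :=
    Measure.isProbabilityMeasure_map hj.aemeasurable
  have h0 : (μ n).map (fun ω => ((S n).α i ω, (S n).α j ω)) (Set.diagonal _) = 0 := by
    rw [hind, Measure.prod_apply hdiag]
    refine (lintegral_congr fun x => ?_).trans lintegral_zero
    refine hac (measure_mono_null (t := {x}) (fun y hy => ?_) (measure_singleton x))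
    exact (Set.mem_diagonal_iff.1 hy).symm
  rw [Measure.map_apply (hi.prodMk hj) hdiag] at h0
  rw [ae_iff]
  refine measure_mono_null (fun ω hω => ?_) h0
  simpa using hω

end Regularities

/-- The field F sees f only at fixed points, so measurability of f at the random point a is not
automatic. Approximating a by simple functions with values in A and using continuity gives an
F-measurable version; the limsup keeps it measurable on all outcomes. -/
theorem exists_measurable_ae_eq_comp {Ω : Type*} {F mΩ : MeasurableSpace Ω} {μ : Measure[mΩ] Ω}
    {E : Type*} [PseudoEMetricSpace E] [MeasurableSpace E] [OpensMeasurableSpace E]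
    [MeasurableSingletonClass E] [SecondCountableTopology E]
    {f : Ω → E → ℝ} {a : Ω → E} {A : Set E} (hf : ∀ x, Measurable[F] fun ω => f ω x)
    (ha : Measurable[F] a) (hA : A.Nonempty)
    (h : ∀ᵐ ω ∂μ, ContinuousOn (f ω) A ∧ a ω ∈ A) :
    ∃ g : Ω → ℝ, Measurable[F] g ∧ (fun ω => f ω (a ω)) =ᵐ[μ] g := by
  obtain ⟨y₀, hy₀⟩ := hA
  let s : ℕ → SimpleFunc E E := fun k => SimpleFunc.approxOn id measurable_id A y₀ hy₀ k
  have hs : ∀ k, Measurable[F] fun ω => f ω (s k (a ω)) := by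
    intro k B hB
    have e : (fun ω => f ω (s k (a ω))) ⁻¹' B
        = ⋃ x ∈ (s k).range, (a ⁻¹' (s k ⁻¹' {x}) ∩ (fun ω => f ω x) ⁻¹' B) := by
      ext ω
      simp only [Set.mem_preimage, Set.mem_iUnion, Set.mem_inter_iff, Set.mem_singleton_iff,
        exists_prop]
      constructor
      · exact fun hω => ⟨_, SimpleFunc.mem_range_self _ _, rfl, hω⟩
      · rintro ⟨x, _, hx, hω⟩
        rwa [hx]
    rw [e]
    exact Finset.measurableSet_biUnion _ fun x _ =>
      (ha ((s k).measurableSet_fiber x)).inter (hf x hB)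
  refine ⟨fun ω => limsup (fun k => f ω (s k (a ω))) atTop, Measurable.limsup hs, ?_⟩
  filter_upwards [h] with ω ⟨hc, hmem⟩
  have h1 : Tendsto (fun k => s k (a ω)) atTop (𝓝[A] (a ω)) :=
    tendsto_nhdsWithin_iff.2 ⟨SimpleFunc.tendsto_approxOn measurable_id hy₀ (subset_closure hmem),
      .of_forall fun k => SimpleFunc.approxOn_mem measurable_id hy₀ k _⟩
  exact (((hc _ hmem).tendsto.comp h1).limsup_eq).symm

/-- A conditional law of a random vector with conditionally independent centered coordinates. -/
theorem exists_condLaw {Ω ι : Type*} [Finite ι] {F mΩ : MeasurableSpace Ω} (hF : F ≤ mΩ)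
    {μ : Measure[mΩ] Ω} [IsProbabilityMeasure μ] {Z : ι → Ω → ℝ} (hZ : ∀ i, Measurable[mΩ] (Z i))
    (hind : CondIndepFamily F μ Z) (hint : ∀ i, Integrable (Z i) μ)
    (hmean : ∀ i, μ[Z i | F] =ᵐ[μ] 0) :
    ∃ κ : Ω → Measure (ι → ℝ), (∀ ω, IsProbabilityMeasure (κ ω)) ∧
      (∀ᵐ ω ∂μ, iIndepFun (fun i (z : ι → ℝ) => z i) (κ ω)) ∧
      (∀ᵐ ω ∂μ, ∀ i, ∫ z, z i ∂κ ω = 0) ∧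
      (∀ g : (ι → ℝ) → ℝ≥0∞, Measurable g →
        condLExp F μ (fun ω => g fun i => Z i ω) =ᵐ[μ] fun ω => ∫⁻ z, g z ∂κ ω) ∧
      ∀ (G : Set Ω) (B : Set (Ω × (ι → ℝ))) (c : ℝ≥0∞), MeasurableSet[F] G →
        MeasurableSet[F.prod MeasurableSpace.pi] B →
        (∀ᵐ ω ∂μ, ω ∈ G → κ ω {z | (ω, z) ∈ B} ≤ c) →
        μ {ω | ω ∈ G ∧ (ω, fun i => Z i ω) ∈ B} ≤ c := by
  -- Conditioning on F is conditioning on the identity map into Ω equipped with F. The law of the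
  -- error vector lives on a standard Borel space even if Ω does not.
  have hX : @Measurable Ω Ω mΩ F id := measurable_id'' hF
  have hcomap : F.comap id = F := MeasurableSpace.comap_id
  have hY : Measurable[mΩ] fun ω i => Z i ω := measurable_pi_lambda _ hZ
  have hind' := @ae_iIndepFun_condDistrib Ω Ω mΩ F μ _ id ι _ Z hX hZ (by rwa [hcomap])
  refine ⟨fun ω => @condDistrib Ω Ω (ι → ℝ) _ _ _ mΩ F (fun ω i => Z i ω) id μ _ ω,
    fun ω => inferInstance, hind', ?_, ?_, ?_⟩
  · have := Fintype.ofFinite ι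
    rw [ae_all_iff]
    intro i
    have h1 := @condExp_ae_eq_integral_condDistrib Ω Ω (ι → ℝ) ℝ _ _ _ _ mΩ μ _ id
      (fun ω i => Z i ω) F _ _ hX hY.aemeasurable (fun z => z i)
      (measurable_pi_apply i).stronglyMeasurable (hint i)
    rw [hcomap] at h1
    filter_upwards [h1, hmean i] with ω h1 h2
    exact h1.symm.trans h2
  · intro g hg
    have h1 := @condLExp_ae_eq_lintegral_condDistrib Ω Ω mΩ F μ _ id (ι → ℝ) _ _ _
      (fun ω i => Z i ω) hX hY g hg
    rwa [hcomap] at h1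
  · intro G B c hG hB h
    exact @measure_inter_le_of_condDistrib_le Ω Ω mΩ F μ _ id (ι → ℝ) _ _ _
      (fun ω i => Z i ω) hX hY G hG B hB c h

end NonlinearFactor

/-! ### Nonasymptotic bound for the denoising error. -/

namespace NonlinearFactor

theorem measurableSet_sum_sq_ge {β : Type*} [MeasurableSpace β] {n p : ℕ} (R : Finset (Fin p))
    (i : Fin n) (s t : ℝ) :
    MeasurableSet {q : β × (Fin n × Fin p → ℝ) | t ≤ |∑ l ∈ R, q.2 (i, l) ^ 2 - s|} := by
  have h : Measurable fun q : β × (Fin n × Fin p → ℝ) => ∑ l ∈ R, q.2 (i, l) ^ 2 - s :=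
    (Finset.measurable_fun_sum _ fun l _ =>
      (show Measurable fun q : β × (Fin n × Fin p → ℝ) => q.2 (i, l) from
        (measurable_pi_apply _).comp measurable_snd).pow_const 2).sub_const s
  exact measurableSet_le measurable_const h.norm

theorem measurableSet_sum_cross_ge {β : Type*} [MeasurableSpace β] {n p : ℕ} (R : Finset (Fin p))
    (i j : Fin n) {c : Fin p → β → ℝ} (hc : ∀ l, Measurable (c l)) (t : ℝ) :
    MeasurableSet {q : β × (Fin n × Fin p → ℝ) |
      t ≤ |∑ l ∈ R, (c l q.1 * (q.2 (i, l) - q.2 (j, l)) - 2 * (q.2 (i, l) * q.2 (j, l)))|} := by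
  suffices h : Measurable fun q : β × (Fin n × Fin p → ℝ) =>
      ∑ l ∈ R, (c l q.1 * (q.2 (i, l) - q.2 (j, l)) - 2 * (q.2 (i, l) * q.2 (j, l))) from
    measurableSet_le measurable_const h.norm
  refine Finset.measurable_fun_sum _ fun l _ => ?_
  have hi : Measurable fun q : β × (Fin n × Fin p → ℝ) => q.2 (i, l) :=
    (measurable_pi_apply _).comp measurable_snd
  have hj : Measurable fun q : β × (Fin n × Fin p → ℝ) => q.2 (j, l) :=
    (measurable_pi_apply _).comp measurable_snd
  exact (((hc l).comp measurable_fst).mul (hi.sub hj)).sub ((hi.mul hj).const_mul 2)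

namespace Sample

variable {r n p : ℕ} {Ω : Type*} [mΩ : MeasurableSpace Ω] (S : Sample r n p Ω)

theorem sqDist_colX_sub (R : Finset (Fin p)) (hR : 0 < R.card) (ω : Ω) (i j : Fin n) (σ : ℝ) :
    sqDist (S.colX R i ω) (S.colX R j ω) - sqDist (S.colH R i ω) (S.colH R j ω) - 2 * σ ^ 2
      = ((∑ l ∈ R, (2 * (S.η l ω (S.α i ω) - S.η l ω (S.α j ω)) * (S.u i l ω - S.u j l ω)
            - 2 * (S.u i l ω * S.u j l ω)))
          + (∑ l ∈ R, S.u i l ω ^ 2 - R.card * σ ^ 2)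
          + (∑ l ∈ R, S.u j l ω ^ 2 - R.card * σ ^ 2)) / R.card := by
  have hD : (R.card : ℝ) ≠ 0 := by exact_mod_cast hR.ne'
  have e : sqDist (S.colX R i ω) (S.colX R j ω)
      = (∑ l ∈ R, (S.η l ω (S.α i ω) + S.u i l ω - (S.η l ω (S.α j ω) + S.u j l ω)) ^ 2)
        / (R.card : ℝ) := by
    rw [sqDist_eq_sum, Fintype.card_coe, ← Finset.sum_coe_sort R]
    rfl
  rw [e, sqDist_colH, eq_div_iff hD, sub_mul, sub_mul, div_mul_cancel₀ _ hD, div_mul_cancel₀ _ hD,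
    ← Finset.sum_sub_distrib]
  have e2 : ∀ l, (S.η l ω (S.α i ω) + S.u i l ω - (S.η l ω (S.α j ω) + S.u j l ω)) ^ 2
      - (S.η l ω (S.α i ω) - S.η l ω (S.α j ω)) ^ 2
      = (2 * (S.η l ω (S.α i ω) - S.η l ω (S.α j ω)) * (S.u i l ω - S.u j l ω)
            - 2 * (S.u i l ω * S.u j l ω)) + S.u i l ω ^ 2 + S.u j l ω ^ 2 := fun l => by ring
  simp only [e2, Finset.sum_add_distrib]
  ring

/-- The threshold is split as t/2 + t/4 + t/4. The square terms involve a single index k, so only n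
such events arise. -/
theorem exists_le_of_le_abs_sqDist_colX_sub (R : Finset (Fin p)) (hR : 0 < R.card) {ω : Ω}
    {i j : Fin n} {σ t : ℝ}
    (h : t ≤ |sqDist (S.colX R i ω) (S.colX R j ω) - sqDist (S.colH R i ω) (S.colH R j ω)
      - 2 * σ ^ 2|) :
    t / 2 * R.card ≤ |∑ l ∈ R, (2 * (S.η l ω (S.α i ω) - S.η l ω (S.α j ω))
          * (S.u i l ω - S.u j l ω) - 2 * (S.u i l ω * S.u j l ω))| ∨
      ∃ k, t / 4 * R.card ≤ |∑ l ∈ R, S.u k l ω ^ 2 - R.card * σ ^ 2| := by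
  have hD : (0 : ℝ) < R.card := by exact_mod_cast hR
  rw [sqDist_colX_sub S R hR, abs_div, abs_of_pos hD, le_div_iff₀ hD] at h
  by_contra hcon
  push Not at hcon
  have h1 := abs_add_three (∑ l ∈ R, (2 * (S.η l ω (S.α i ω) - S.η l ω (S.α j ω))
          * (S.u i l ω - S.u j l ω) - 2 * (S.u i l ω * S.u j l ω)))
        (∑ l ∈ R, S.u i l ω ^ 2 - R.card * σ ^ 2) (∑ l ∈ R, S.u j l ω ^ 2 - R.card * σ ^ 2)
  have h2 := hcon.2 i
  have h3 := hcon.2 j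
  linarith [hcon.1]

theorem measurable_condMoment (μ : Measure Ω) (q : ℝ) (i : Fin n) (l : Fin p) :
    Measurable[S.latentField] (S.condMoment μ q i l) :=
  measurable_condLExp _ _ _

theorem measurable_α_latentField (i : Fin n) : Measurable[S.latentField] (S.α i) := by
  refine Measurable.of_comap_le (le_trans ?_ le_sup_left)
  exact le_iSup (fun i => MeasurableSpace.comap (S.α i) inferInstance) i

theorem measurable_η_latentField (l : Fin p) (x : EuclideanSpace ℝ (Fin r)) :
    Measurable[S.latentField] fun ω => S.η l ω x := by
  refine Measurable.of_comap_le (le_trans ?_ le_sup_right)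
  exact le_iSup_of_le l
    (le_iSup (fun x => MeasurableSpace.comap (fun ω => S.η l ω x) inferInstance) x)

end Sample

/-- Only the average of the conditional variances is prescribed. That suffices: centring each square
at its own mean subtracts Dσ² in total. -/
theorem sum_integral_sq_eq {ι : Type*} {P : Measure (ι → ℝ)} (R : Finset ι) (hR : 0 < R.card)
    {σ : ℝ}
    (h : (∑ i ∈ R, ∫⁻ z, ENNReal.ofReal (|z i| ^ (2 : ℝ)) ∂P) / (R.card : ℝ≥0∞)
      = ENNReal.ofReal (σ ^ 2)) :
    ∑ i ∈ R, ∫ z, z i ^ 2 ∂P = R.card * σ ^ 2 := by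
  have hD : (R.card : ℝ≥0∞) ≠ 0 := by exact_mod_cast hR.ne'
  replace h := ((ENNReal.eq_div_iff hD (ENNReal.natCast_ne_top _)).1 h.symm).symm
  have hfin : ∑ i ∈ R, ∫⁻ z, ENNReal.ofReal (|z i| ^ (2 : ℝ)) ∂P ≠ ∞ := by
    rw [h]; exact ENNReal.mul_ne_top (ENNReal.natCast_ne_top _) ENNReal.ofReal_ne_top
  have e : ∀ i, ∫ z, z i ^ 2 ∂P = (∫⁻ z, ENNReal.ofReal (|z i| ^ (2 : ℝ)) ∂P).toReal := by
    intro i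
    rw [integral_eq_lintegral_of_nonneg_ae (.of_forall fun z => sq_nonneg _)
      ((measurable_pi_apply i).pow_const 2).aestronglyMeasurable]
    simp only [Real.rpow_two, sq_abs]
  simp only [e]
  rw [← ENNReal.toReal_sum fun i hi => (ENNReal.sum_ne_top.1 hfin) i hi, h, ENNReal.toReal_mul,
    ENNReal.toReal_natCast, ENNReal.toReal_ofReal (sq_nonneg σ)]

/-- Union bound over the event of large conditional moments, the n square events and the n² cross
events, the last two being bounded conditionally on the complement of the first. -/
theorem exists_measure_denoising_le {ν M C : ℝ} (hν : 0 < ν) (hM : 1 ≤ M) (hC : 0 ≤ C) :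
    ∃ L : ℝ, 0 ≤ L ∧ ∀ {r n p : ℕ} {Ω : Type*} [MeasurableSpace Ω] (S : Sample r n p Ω)
      (μ : Measure Ω) [IsProbabilityMeasure μ] (R : Finset (Fin p))
      (A : Set (EuclideanSpace ℝ (Fin r))) (σ : ℝ),
      (∀ i l, Integrable (S.u i l) μ) →
      (∀ i l, μ[S.u i l | S.latentField] =ᵐ[μ] 0) →
      CondIndepFamily S.latentField μ (fun q : Fin n × Fin p => S.u q.1 q.2) →
      A.Nonempty → (∀ i, ∀ᵐ ω ∂μ, S.α i ω ∈ A) →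
      (∀ᵐ ω ∂μ, ∀ l, ContinuousOn (S.η l ω) A) →
      (∀ᵐ ω ∂μ, ∀ l, ∀ x ∈ A, |S.η l ω x| ≤ C) →
      (∀ i, ∀ᵐ ω ∂μ, (∑ l ∈ R, S.condMoment μ 2 i l ω) / (R.card : ℝ≥0∞)
        = ENNReal.ofReal (σ ^ 2)) →
      0 < R.card → ∀ t : ℝ, 0 < t →
      μ {ω | t ≤ |⨆ q : {q : Fin n × Fin n // q.1 ≠ q.2},
        (|sqDist (S.colX R q.1.1 ω) (S.colX R q.1.2 ω)
          - sqDist (S.colH R q.1.1 ω) (S.colH R q.1.2 ω) - 2 * σ ^ 2|)|}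
      ≤ μ {ω | ENNReal.ofReal M ≤ ⨆ i, ⨆ l ∈ R, S.condMoment μ (4 + 2 * ν) i l ω}
        + (n * ENNReal.ofReal (L * (R.card * (t / 4) ^ 2) ^ (-((2 + ν) / 2)))
          + (n * n : ℕ) * ENNReal.ofReal (L * (R.card * (t / 2) ^ 2) ^ (-(2 + ν)))) := by
  obtain ⟨L1, hL1, H1⟩ := exists_measure_sum_sq_sub_ge_le hν hM
  obtain ⟨L2, hL2, H2⟩ := exists_measure_sum_cross_ge_le hν hM (C := 4 * C) (by positivity)
  refine ⟨max L1 L2, le_max_of_le_left hL1, ?_⟩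
  intro r n p Ω _ S μ _ R A σ hint hmean hind hA hα hcont hbd hvar hR t ht
  obtain ⟨κ, hκ, κind, κmean, κmom, κbound⟩ := exists_condLaw S.latentField_le
    (fun q : Fin n × Fin p => S.measurable_u q.1 q.2) hind (fun q => hint q.1 q.2)
    (fun q => hmean q.1 q.2)
  have hg : ∀ i l, ∃ g : Ω → ℝ, Measurable[S.latentField] g ∧
      (fun ω => S.η l ω (S.α i ω)) =ᵐ[μ] g := fun i l =>
    exists_measurable_ae_eq_comp (fun x => S.measurable_η_latentField l x)
      (S.measurable_α_latentField i) hA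
      (by filter_upwards [hcont, hα i] with ω h1 h2 using ⟨h1 l, h2⟩)
  choose g gmeas geq using hg
  have κmomeq : ∀ q : ℝ, 0 ≤ q → ∀ᵐ ω ∂μ, ∀ i l, S.condMoment μ q i l ω
      = ∫⁻ z, ENNReal.ofReal (|z (i, l)| ^ q) ∂κ ω := by
    intro q hq
    simp only [ae_all_iff]
    intro i l
    exact κmom (fun z => ENNReal.ofReal (|z (i, l)| ^ q))
      ((measurable_pi_apply (i, l)).norm.pow_const q).ennreal_ofReal
  let G : Set Ω := {ω | ⨆ i, ⨆ l ∈ R, S.condMoment μ (4 + 2 * ν) i l ω < ENNReal.ofReal M}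
  have hG : MeasurableSet[S.latentField] G := by
    have : Measurable[S.latentField] fun ω => ⨆ i, ⨆ l ∈ R, S.condMoment μ (4 + 2 * ν) i l ω :=
      Measurable.iSup fun i => Measurable.iSup fun l => Measurable.iSup fun _ =>
        S.measurable_condMoment μ _ i l
    exact this measurableSet_Iio
  -- The latent-field measurable versions g replace η_l(α_i), so that the cross event is measurable
  -- for the product with the latent field; almost surely |c| ≤ 4C.
  let c : Fin n → Fin n → Fin p → Ω → ℝ := fun i j l ω => 2 * (g i l ω - g j l ω)
  have hc : ∀ i j l, Measurable[S.latentField] (c i j l) := fun i j l =>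
    ((gmeas i l).sub (gmeas j l)).const_mul 2
  let D : ℝ := R.card
  let B1 : Fin n → Set (Ω × (Fin n × Fin p → ℝ)) := fun i =>
    {q | t / 4 * D ≤ |∑ l ∈ R, q.2 (i, l) ^ 2 - D * σ ^ 2|}
  let B2 : Fin n → Fin n → Set (Ω × (Fin n × Fin p → ℝ)) := fun i j =>
    {q | t / 2 * D ≤ |∑ l ∈ R, (c i j l q.1 * (q.2 (i, l) - q.2 (j, l))
      - 2 * (q.2 (i, l) * q.2 (j, l)))|}
  have hmomG : ∀ᵐ ω ∂μ, ω ∈ G → ∀ i, ∀ l ∈ R,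
      ∫⁻ z, ENNReal.ofReal (|z (i, l)| ^ (4 + 2 * ν)) ∂κ ω ≤ ENNReal.ofReal M := by
    filter_upwards [κmomeq (4 + 2 * ν) (by linarith)] with ω h hω i l hl
    rw [← h i l]
    refine le_trans ?_ (le_of_lt hω)
    exact le_iSup_of_le i (le_iSup₂_of_le l hl le_rfl)
  have b1 : ∀ i, μ {ω | ω ∈ G ∧ (ω, fun q : Fin n × Fin p => S.u q.1 q.2 ω) ∈ B1 i}
      ≤ ENNReal.ofReal (max L1 L2 * (D * (t / 4) ^ 2) ^ (-((2 + ν) / 2))) := by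
    intro i
    refine κbound G (B1 i) _ hG
      (@measurableSet_sum_sq_ge Ω S.latentField n p R i (D * σ ^ 2) (t / 4 * D)) ?_
    filter_upwards [hmomG, κind, κmomeq 2 zero_le_two, hvar i] with ω h1 h2 h3 h4 hω
    have := hκ ω
    have h5 := H1 (κ ω) h2 R i hR (h1 hω i) (t / 4) (by positivity)
    simp only [h3] at h4
    have h6 : ∑ l ∈ R, ∫ z, z (i, l) ^ 2 ∂κ ω = D * σ ^ 2 := by
      have := sum_integral_sq_eq (P := κ ω) (σ := σ) (R.image fun l => (i, l))
        (by simpa [Finset.card_image_of_injective _ (Prod.mk_right_injective i)] using hR)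
      rw [Finset.card_image_of_injective _ (Prod.mk_right_injective i),
        Finset.sum_image (Prod.mk_right_injective i).injOn,
        Finset.sum_image (Prod.mk_right_injective i).injOn] at this
      exact this h4
    simp only [Finset.sum_sub_distrib, h6] at h5
    refine h5.trans (ENNReal.ofReal_le_ofReal ?_)
    gcongr
    exact le_max_left _ _
  have b2 : ∀ i j, μ {ω | i ≠ j ∧ ω ∈ G ∧ (ω, fun q : Fin n × Fin p => S.u q.1 q.2 ω) ∈ B2 i j}
      ≤ ENNReal.ofReal (max L1 L2 * (D * (t / 2) ^ 2) ^ (-(2 + ν))) := by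
    intro i j
    by_cases hij : i = j
    · simp [hij]
    refine (measure_mono fun ω hω => hω.2).trans ?_
    refine κbound G (B2 i j) _ hG (@measurableSet_sum_cross_ge Ω S.latentField n p R i j
      (c i j) (hc i j) (t / 2 * D)) ?_
    have hgeq : ∀ᵐ ω ∂μ, ∀ i l, S.η l ω (S.α i ω) = g i l ω := by
      simp only [ae_all_iff]; exact geq
    filter_upwards [hmomG, κind, κmean, hgeq, hα i, hα j, hbd] with ω h1 h2 h3 h4 h5 h6 h7 hω
    have := hκ ω
    refine (H2 (κ ω) h2 R i j (fun l => c i j l ω) hij hR (fun l _ => ?_)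
      (fun i l _ => h3 (i, l)) (h1 hω) (t / 2) (by positivity)).trans
      (ENNReal.ofReal_le_ofReal ?_)
    · have e1 := h7 l _ h5
      have e2 := h7 l _ h6
      rw [h4] at e1 e2
      rw [abs_le] at e1 e2 ⊢
      simp only [c]
      constructor <;> linarith [e1.1, e1.2, e2.1, e2.2]
    · gcongr
      exact le_max_right _ _
  have hgeq : ∀ᵐ ω ∂μ, ∀ i l, S.η l ω (S.α i ω) = g i l ω := by
    simp only [ae_all_iff]; exact geq
  calc _ ≤ μ (Gᶜ ∪ ((⋃ i, {ω | ω ∈ G ∧ (ω, fun q : Fin n × Fin p => S.u q.1 q.2 ω) ∈ B1 i}) ∪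
          ⋃ q : Fin n × Fin n, {ω | q.1 ≠ q.2 ∧ ω ∈ G ∧
            (ω, fun q : Fin n × Fin p => S.u q.1 q.2 ω) ∈ B2 q.1 q.2})) := by
        refine measure_mono_ae ?_
        filter_upwards [hgeq] with ω hω hmem
        by_cases hGω : ω ∈ G
        swap
        · exact Or.inl hGω
        right
        change t ≤ _ at hmem
        rcases isEmpty_or_nonempty {q : Fin n × Fin n // q.1 ≠ q.2} with hE | hE
        -- Without pairs the real supremum is 0, which is below the positive threshold.
        · rw [Real.iSup_of_isEmpty, abs_zero] at hmem
          exact absurd hmem (not_le.2 ht)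
        obtain ⟨⟨⟨i, j⟩, hij⟩, hq⟩ := exists_eq_ciSup_of_finite
          (f := fun q : {q : Fin n × Fin n // q.1 ≠ q.2} =>
            |sqDist (S.colX R q.1.1 ω) (S.colX R q.1.2 ω)
              - sqDist (S.colH R q.1.1 ω) (S.colH R q.1.2 ω) - 2 * σ ^ 2|)
        rw [← hq, abs_abs] at hmem
        rcases S.exists_le_of_le_abs_sqDist_colX_sub R hR hmem with h | ⟨k, h⟩
        · right
          simp only [hω] at h
          exact Set.mem_iUnion.2 ⟨(i, j), hij, hGω, h⟩
        · left
          exact Set.mem_iUnion.2 ⟨k, hGω, h⟩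
    _ ≤ _ := by
        refine (measure_union_le _ _).trans (add_le_add ?_ ((measure_union_le _ _).trans
          (add_le_add ?_ ?_)))
        · refine measure_mono fun ω hω => ?_
          rcases lt_or_ge (⨆ i, ⨆ l ∈ R, S.condMoment μ (4 + 2 * ν) i l ω) (ENNReal.ofReal M)
            with h | h
          · exact absurd (show ω ∈ G from h) hω
          · exact h
        · refine (measure_iUnion_fintype_le _ _).trans ((Finset.sum_le_sum fun i _ => b1 i).trans ?_)
          simp [D]
        · refine (measure_iUnion_fintype_le _ _).trans
            ((Finset.sum_le_sum fun q _ => b2 q.1 q.2).trans ?_)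
          simp [D]

end NonlinearFactor

/-! ### Consequences of the growth condition on p. -/

section Rates

theorem tendsto_log_rpow_mul_rpow_neg {s t : ℝ} (ht : 0 < t) :
    Tendsto (fun n : ℕ => Real.log n ^ s * (n : ℝ) ^ (-t)) atTop (𝓝 0) := by
  have h := ((isLittleO_log_rpow_rpow_atTop s ht).tendsto_div_nhds_zero).comp
    tendsto_natCast_atTop_atTop
  refine h.congr fun n => ?_
  simp only [Function.comp, div_eq_mul_inv, Real.rpow_neg (Nat.cast_nonneg n)]

variable {p : ℕ → ℕ} {ν : ℝ}

theorem exists_rpow_mul_log_le (hp : Tendsto p atTop atTop)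
    (hrate : (fun n : ℕ => (n : ℝ) ^ (4 / ν) * Real.log n ^ ((ν - 2) / ν) / (p n : ℝ))
      =O[atTop] fun _ => (1 : ℝ)) :
    ∃ K : ℝ, 0 < K ∧ ∀ᶠ n : ℕ in atTop, 0 < (n : ℝ) ∧ 0 < Real.log n ∧ 0 < (p n : ℝ) ∧
      (n : ℝ) ^ (4 / ν) * Real.log n ^ ((ν - 2) / ν) ≤ K * p n := by
  obtain ⟨K, hK, h⟩ := hrate.exists_pos
  refine ⟨K, hK, ?_⟩
  filter_upwards [h.bound, hp.eventually_gt_atTop 0, eventually_ge_atTop 2] with n h1 h2 h3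
  have hp0 : (0 : ℝ) < p n := by exact_mod_cast h2
  have hn : (1 : ℝ) < n := by exact_mod_cast (by omega : 1 < n)
  refine ⟨by linarith, Real.log_pos hn, hp0, ?_⟩
  rw [norm_one, mul_one] at h1
  have h4 := (le_abs_self _).trans h1
  rwa [div_le_iff₀ hp0] at h4

theorem tendsto_log_div_rpow (hν : 0 < ν) (hp : Tendsto p atTop atTop)
    (hrate : (fun n : ℕ => (n : ℝ) ^ (4 / ν) * Real.log n ^ ((ν - 2) / ν) / (p n : ℝ))
      =O[atTop] fun _ => (1 : ℝ)) :
    Tendsto (fun n : ℕ => (Real.log n / (p n : ℝ)) ^ ((1 : ℝ) / 4)) atTop (𝓝 0) := by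
  obtain ⟨K, hK, h⟩ := exists_rpow_mul_log_le hp hrate
  have h0 : Tendsto (fun n : ℕ => Real.log n / (p n : ℝ)) atTop (𝓝 0) := by
    have h1 := (tendsto_log_rpow_mul_rpow_neg (s := 2 / ν) (t := 4 / ν) (by positivity)).const_mul K
    rw [mul_zero] at h1
    refine tendsto_of_tendsto_of_tendsto_of_le_of_le' tendsto_const_nhds h1 ?_ ?_
    · filter_upwards [h] with n ⟨_, h2, h3, _⟩ using by positivity
    · filter_upwards [h] with n ⟨hn, hl, hp0, hb⟩
      rw [div_le_iff₀ hp0]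
      have e : Real.log n = Real.log n ^ (2 / ν) * (n : ℝ) ^ (-(4 / ν))
          * ((n : ℝ) ^ (4 / ν) * Real.log n ^ ((ν - 2) / ν)) := by
        rw [Real.rpow_neg hn.le]
        have h1 : Real.log n = Real.log n ^ (2 / ν) * Real.log n ^ ((ν - 2) / ν) := by
          rw [← Real.rpow_add hl, ← add_div, add_sub_cancel, div_self hν.ne', Real.rpow_one]
        have h2 : (n : ℝ) ^ (4 / ν) ≠ 0 := by positivity
        conv_lhs => rw [h1]
        field_simp
      calc Real.log n = _ := e
        _ ≤ Real.log n ^ (2 / ν) * (n : ℝ) ^ (-(4 / ν)) * (K * p n) := by gcongr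
        _ = _ := by ring
  have := h0.rpow_const (p := (1 : ℝ) / 4) (Or.inr (by norm_num))
  rwa [Real.zero_rpow (by norm_num)] at this

/-- The base is of order at least (p log n)^(1/2), and p log n is at least a multiple of n^(4/ν)
(log n)^(2 - 2/ν). Raising to the power -(2+ν)/4 gives n^(-(2+ν)/ν), and the factor n leaves
n^(-2/ν); the power of the logarithm is harmless whatever its sign. -/
theorem tendsto_mul_card_mul_sq_rpow (hν : 0 < ν) (hp : Tendsto p atTop atTop)
    (hrate : (fun n : ℕ => (n : ℝ) ^ (4 / ν) * Real.log n ^ ((ν - 2) / ν) / (p n : ℝ))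
      =O[atTop] fun _ => (1 : ℝ)) {D : ℕ → ℝ} (hD : D =Θ[atTop] fun n => (p n : ℝ))
    (hD0 : ∀ n, 0 ≤ D n) :
    Tendsto (fun n : ℕ => (n : ℝ) * (D n * ((Real.log n / (p n : ℝ)) ^ ((1 : ℝ) / 4) / 4) ^ 2)
      ^ (-((2 + ν) / 2))) atTop (𝓝 0) := by
  obtain ⟨K, hK, h⟩ := exists_rpow_mul_log_le hp hrate
  obtain ⟨K', hK', h'⟩ := hD.2.exists_pos
  set s := -((2 - 2 / ν) * ((2 + ν) / 4)) with hs
  have hlim := (tendsto_log_rpow_mul_rpow_neg (s := s) (t := 2 / ν) (by positivity)).const_mul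
    ((1 / (16 * K')) ^ (-((2 + ν) / 2)) * K ^ ((2 + ν) / 4))
  rw [mul_zero] at hlim
  refine tendsto_of_tendsto_of_tendsto_of_le_of_le' tendsto_const_nhds hlim
    (.of_forall fun n => ?_) ?_
  · have := hD0 n
    positivity
  filter_upwards [h, h'.bound] with n ⟨hn, hl, hp0, hb⟩ hpD
  rw [Real.norm_of_nonneg hp0.le, Real.norm_of_nonneg (hD0 n)] at hpD
  set ℓ := Real.log n
  set P : ℝ := (p n : ℝ)
  have hq : -((2 + ν) / 2) ≤ 0 := by linarith
  have hsq : ((ℓ / P) ^ ((1 : ℝ) / 4)) ^ 2 = (ℓ / P) ^ ((1 : ℝ) / 2) := by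
    rw [← Real.rpow_natCast, ← Real.rpow_mul (by positivity)]
    norm_num
  have hroot : P * (ℓ / P) ^ ((1 : ℝ) / 2) = (P * ℓ) ^ ((1 : ℝ) / 2) := by
    have : P = (P ^ 2) ^ ((1 : ℝ) / 2) := by
      rw [← Real.rpow_natCast, ← Real.rpow_mul hp0.le]; norm_num
    conv_lhs => rw [this, ← Real.mul_rpow (by positivity) (by positivity)]
    congr 1
    rw [← this]
    field_simp
  have hlow : 1 / (16 * K') * (P * ℓ) ^ ((1 : ℝ) / 2)
      ≤ D n * ((ℓ / P) ^ ((1 : ℝ) / 4) / 4) ^ 2 := by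
    rw [div_pow, hsq, ← hroot]
    have h1 : P / K' ≤ D n := by rw [div_le_iff₀ hK']; linarith
    calc 1 / (16 * K') * (P * (ℓ / P) ^ ((1 : ℝ) / 2))
        = P / K' * ((ℓ / P) ^ ((1 : ℝ) / 2) / 4 ^ 2) := by ring
      _ ≤ _ := by gcongr
  have hPl : K⁻¹ * ((n : ℝ) ^ (4 / ν) * ℓ ^ (2 - 2 / ν)) ≤ P * ℓ := by
    have e : ℓ ^ (2 - 2 / ν) = ℓ ^ ((ν - 2) / ν) * ℓ := by
      rw [← Real.rpow_add_one hl.ne']; congr 1; field_simp; ring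
    rw [e, inv_mul_le_iff₀ hK]
    nlinarith [mul_le_mul_of_nonneg_right hb hl.le]
  have hfac : (P * ℓ) ^ (-((2 + ν) / 4))
      ≤ K ^ ((2 + ν) / 4) * ((n : ℝ) ^ (-((2 + ν) / ν)) * ℓ ^ s) := by
    refine (Real.rpow_le_rpow_of_nonpos (by positivity) hPl (by linarith)).trans (le_of_eq ?_)
    rw [Real.mul_rpow (by positivity) (by positivity), Real.mul_rpow (by positivity) (by positivity),
      ← Real.rpow_mul hn.le, ← Real.rpow_mul hl.le, Real.inv_rpow hK.le, ← Real.rpow_neg hK.le,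
      neg_neg]
    congr 3
    · field_simp
    · rw [hs]; ring
  calc (n : ℝ) * (D n * ((ℓ / P) ^ ((1 : ℝ) / 4) / 4) ^ 2) ^ (-((2 + ν) / 2))
      ≤ n * (1 / (16 * K') * (P * ℓ) ^ ((1 : ℝ) / 2)) ^ (-((2 + ν) / 2)) := by
        gcongr ?_ * ?_
        exact Real.rpow_le_rpow_of_nonpos (by positivity) hlow hq
    _ = n * ((1 / (16 * K')) ^ (-((2 + ν) / 2)) * (P * ℓ) ^ (-((2 + ν) / 4))) := by
        rw [Real.mul_rpow (by positivity) (by positivity), ← Real.rpow_mul (by positivity)]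
        congr 3; ring
    _ ≤ n * ((1 / (16 * K')) ^ (-((2 + ν) / 2)) *
          (K ^ ((2 + ν) / 4) * ((n : ℝ) ^ (-((2 + ν) / ν)) * ℓ ^ s))) := by gcongr
    _ = (1 / (16 * K')) ^ (-((2 + ν) / 2)) * K ^ ((2 + ν) / 4)
          * (ℓ ^ s * ((n : ℝ) ^ (-((2 + ν) / ν)) * n)) := by ring
    _ = _ := by
        rw [← Real.rpow_add_one hn.ne']
        congr 3; field_simp; ring

theorem eventually_pos_of_isTheta (hp : Tendsto p atTop atTop) {k : ℕ → ℕ}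
    (hk : (fun n => (k n : ℝ)) =Θ[atTop] fun n => (p n : ℝ)) : ∀ᶠ n in atTop, 0 < k n := by
  obtain ⟨K, _, h⟩ := hk.2.exists_pos
  filter_upwards [h.bound, hp.eventually_gt_atTop 0] with n h1 h2
  by_contra h0
  have : k n = 0 := by omega
  simp [this] at h1
  omega

end Rates

/-! ### The three indirect-matching bounds and the theorem. -/

namespace NonlinearFactor

variable {r : ℕ} {p : ℕ → ℕ} {Ω : ℕ → Type*} [∀ n, MeasurableSpace (Ω n)]
  {μ : ∀ n, Measure (Ω n)} [∀ n, IsProbabilityMeasure (μ n)]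
  {S : ∀ n, Sample r n (p n) (Ω n)} {A : Set (EuclideanSpace ℝ (Fin r))} {m : ℕ} {ν : ℝ}

namespace Regularities

theorem bigOP_denoising (hreg : Regularities μ S A m ν) (hν : 0 < ν) (σ : ℝ)
    (hp : Tendsto p atTop atTop) {R : ∀ n, Finset (Fin (p n))}
    (hR : (fun n => ((R n).card : ℝ)) =Θ[atTop] fun n => (p n : ℝ))
    (h_var : ∀ n, ∀ i : Fin n, ∀ᵐ ω ∂μ n,
      (∑ l ∈ R n, (S n).condMoment (μ n) 2 i l ω) / ((R n).card : ℝ≥0∞) = ENNReal.ofReal (σ ^ 2))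
    (h_mom : StochBounded μ fun n ω =>
      ⨆ i, ⨆ l ∈ R n, (S n).condMoment (μ n) (4 + 2 * ν) i l ω)
    (hrate : (fun n : ℕ => (n : ℝ) ^ (4 / ν) * Real.log n ^ ((ν - 2) / ν) / (p n : ℝ))
      =O[atTop] fun _ => (1 : ℝ)) :
    BigOP μ
      (fun n ω => ⨆ q : {q : Fin n × Fin n // q.1 ≠ q.2},
        |sqDist ((S n).colX (R n) q.1.1 ω) ((S n).colX (R n) q.1.2 ω)
          - sqDist ((S n).colH (R n) q.1.1 ω) ((S n).colH (R n) q.1.2 ω) - 2 * σ ^ 2|)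
      (fun n _ => (Real.log n / (p n : ℝ)) ^ ((1 : ℝ) / 4)) := by
  obtain ⟨C, hC, hbd⟩ := hreg.exists_ae_partialsBounded
  obtain ⟨K, _, hlog⟩ := exists_rpow_mul_log_le hp hrate
  -- The exceedance probability at level a_n already tends to zero, so threshold 1 works for every
  -- δ.
  refine bigOP_of_forall fun δ hδ => ⟨1, fun ε hε => ?_⟩
  have hδ2 : 0 < δ / 2 := ENNReal.half_pos hδ.ne'
  obtain ⟨M, hM, hmom⟩ := h_mom.exists_eventually_le hδ2
  obtain ⟨L, hL, H⟩ := exists_measure_denoising_le hν hM hC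
  have hy := tendsto_mul_card_mul_sq_rpow hν hp hrate hR fun n => by positivity
  set y : ℕ → ℝ := fun n => (n : ℝ) * (((R n).card : ℝ) *
    ((Real.log n / (p n : ℝ)) ^ ((1 : ℝ) / 4) / 4) ^ 2) ^ (-((2 + ν) / 2)) with hydef
  have hlim : Tendsto (fun n => ENNReal.ofReal (L * y n + L * y n ^ 2)) atTop (𝓝 0) := by
    have := ENNReal.tendsto_ofReal ((hy.const_mul L).add ((hy.pow 2).const_mul L))
    simpa using this
  have hDpos := eventually_pos_of_isTheta hp hR
  filter_upwards [hmom, hlim.eventually_le_const hδ2, hDpos, hlog] with n h1 h2 h3 ⟨hn, hl, hp0, _⟩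
  set a := (Real.log n / (p n : ℝ)) ^ ((1 : ℝ) / 4) with ha
  have ha0 : 0 < a := by positivity
  have hsub := H (S n) (μ n) (R n) A σ (hreg.integrable_u n) (hreg.condMean_u n)
    (hreg.condIndep_u n) (hreg.interior_nonempty.mono interior_subset)
    (fun i => hreg.ae_α_mem i) ((hreg.smooth n).mono fun ω h l => (h l).continuousOn)
    ((hbd n).mono fun ω h l x hx => (h l).abs_le hx) (h_var n) h3 a ha0
  refine (measure_mono fun ω hω => ?_).trans (hsub.trans ((add_le_add h1 ?_).trans
    (ENNReal.add_halves δ).le))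
  · change ε * |a| ≤ _ at hω
    change a ≤ _
    refine le_trans ?_ hω
    rw [abs_of_pos ha0]
    nlinarith
  · refine le_trans ?_ h2
    have hD : (0 : ℝ) < (R n).card := by exact_mod_cast h3
    have hnn : 0 ≤ y n := by positivity
    rw [ENNReal.ofReal_add (by positivity) (by positivity)]
    refine add_le_add ?_ ?_
    · rw [← ENNReal.ofReal_natCast, ← ENNReal.ofReal_mul (Nat.cast_nonneg _)]
      refine ENNReal.ofReal_le_ofReal (le_of_eq ?_)
      simp only [hydef]; ring
    · rw [← ENNReal.ofReal_natCast, ← ENNReal.ofReal_mul (Nat.cast_nonneg _)]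
      refine ENNReal.ofReal_le_ofReal ?_
      -- The n² cross events with the doubled exponent cost exactly y², once a/2 is replaced by a/4.
      have e : y n ^ 2 = (n : ℝ) * n * (((R n).card : ℝ) * (a / 4) ^ 2) ^ (-(2 + ν)) := by
        simp only [hydef]
        rw [mul_pow, ← Real.rpow_natCast (_ ^ (-((2 + ν) / 2))), ← Real.rpow_mul (by positivity)]
        rw [pow_two]
        congr 2; push_cast; ring
      have h4 : (((R n).card : ℝ) * (a / 2) ^ 2) ^ (-(2 + ν))
          ≤ (((R n).card : ℝ) * (a / 4) ^ 2) ^ (-(2 + ν)) := by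
        refine Real.rpow_le_rpow_of_nonpos (by positivity) ?_ (by linarith)
        gcongr
        norm_num
      rw [e, Nat.cast_mul]
      calc (n : ℝ) * n * (L * (((R n).card : ℝ) * (a / 2) ^ 2) ^ (-(2 + ν)))
          ≤ (n : ℝ) * n * (L * (((R n).card : ℝ) * (a / 4) ^ 2) ^ (-(2 + ν))) := by gcongr
        _ = _ := by ring

theorem bigOP_sqDist_div (hreg : Regularities μ S A m ν) (hm : 2 ≤ m)
    (R : ∀ n, Finset (Fin (p n))) :
    BigOP μ
      (fun n ω => ⨆ q : {q : Fin n × Fin n // (S n).α q.1 ω ≠ (S n).α q.2 ω},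
        sqDist ((S n).colH (R n) q.1.1 ω) ((S n).colH (R n) q.1.2 ω)
          / ‖(S n).α q.1.1 ω - (S n).α q.1.2 ω‖ ^ (2 : ℝ))
      (fun _ _ => 1) := by
  obtain ⟨C, hC, hbd⟩ := hreg.exists_ae_partialsBounded
  refine bigOP_of_forall fun δ hδ => ⟨(r * C) ^ 2 + 1, fun ε hε => .of_forall fun n => ?_⟩
  refine le_trans (le_of_eq ?_) (zero_le (a := δ))
  have hmem : ∀ᵐ ω ∂μ n, ∀ i, (S n).α i ω ∈ A := ae_all_iff.2 fun i => hreg.ae_α_mem i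
  have key : ∀ᵐ ω ∂μ n, ¬ ε * |(1 : ℝ)| ≤
      |⨆ q : {q : Fin n × Fin n // (S n).α q.1 ω ≠ (S n).α q.2 ω},
        sqDist ((S n).colH (R n) q.1.1 ω) ((S n).colH (R n) q.1.2 ω)
          / ‖(S n).α q.1.1 ω - (S n).α q.1.2 ω‖ ^ (2 : ℝ)| := by
    filter_upwards [hreg.smooth n, hbd n, hmem] with ω h1 h2 h3
    rw [abs_of_nonneg (Real.iSup_nonneg fun q => ?_), abs_one, mul_one, not_le]
    · refine lt_of_le_of_lt (Real.iSup_le (fun q => ?_) (by positivity))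
        (show (r * C) ^ 2 < ε by linarith)
      have hne : 0 < ‖(S n).α q.1.1 ω - (S n).α q.1.2 ω‖ := norm_pos_iff.2 (sub_ne_zero.2 q.2)
      rw [Real.rpow_two, div_le_iff₀ (by positivity)]
      exact (S n).sqDist_colH_le (R n) hm hreg.uniqueDiffOn hreg.convex h1 h2 (h3 _) (h3 _)
    · unfold sqDist; positivity
  have := ae_iff.1 key
  simpa only [not_not] using this

theorem bigOP_one_sqDist_div (hreg : Regularities μ S A m ν) (hr : 0 < r) (hm : 2 ≤ m)
    (hp : Tendsto p atTop atTop) {R : ∀ n, Finset (Fin (p n))}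
    (hR : (fun n => ((R n).card : ℝ)) =Θ[atTop] fun n => (p n : ℝ))
    (h_far : ∀ ε : ℝ, 0 < ε →
      Tendsto (fun Δ : ℝ => limsup (fun n : ℕ => μ n {ω | ∃ i j : Fin n,
          sqDist ((S n).colH (R n) i ω) ((S n).colH (R n) j ω) < Δ ∧
          ε < ‖(S n).α i ω - (S n).α j ω‖}) atTop)
        (𝓝[>] 0) (𝓝 0))
    (h_gram : ∃ c : ℝ, 0 < c ∧
      Tendsto (fun n : ℕ => μ n {ω | ¬ ∀ i : Fin n,
          c ≤ sMin ((S n).gram A (R n) ω ((S n).α i ω))}) atTop (𝓝 0)) :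
    BigOP μ (fun _ _ => 1)
      (fun n ω => ⨅ q : {q : Fin n × Fin n // (S n).α q.1 ω ≠ (S n).α q.2 ω},
        sqDist ((S n).colH (R n) q.1.1 ω) ((S n).colH (R n) q.1.2 ω)
          / ‖(S n).α q.1.1 ω - (S n).α q.1.2 ω‖ ^ (2 : ℝ)) := by
  obtain ⟨C, hC, hbd⟩ := hreg.exists_ae_partialsBounded
  obtain ⟨c, hc, hgram⟩ := h_gram
  refine bigOP_of_forall fun δ hδ => ?_
  have hδ2 : 0 < δ / 2 := ENNReal.half_pos hδ.ne'
  set K : ℝ := (r * (r * C)) ^ 2 with hK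
  have hK0 : 0 ≤ K := by positivity
  -- Separation between close and distant pairs: the largest radius for Taylor, up to K + 1 in place
  -- of K, which avoids dividing by zero.
  set η := √(c / (4 * (K + 1))) with hη
  have hη0 : 0 < η := Real.sqrt_pos.2 (by positivity)
  have hη2 : K * η ^ 2 ≤ c / 4 := by
    rw [hη, Real.sq_sqrt (by positivity), mul_div_assoc', div_le_div_iff₀ (by positivity)
      (by norm_num)]
    nlinarith
  obtain ⟨Δ, hΔ, hΔ0⟩ := (((h_far η hη0).eventually_lt_const hδ2).and
    self_mem_nhdsWithin).exists
  have hΔ0' : (0 : ℝ) < Δ := hΔ0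
  have hfar := eventually_lt_of_limsup_lt hΔ
  set d := Metric.diam A + 1 with hd
  have hd0 : 0 < d := by have := Metric.diam_nonneg (s := A); linarith
  -- The constants for close and for distant pairs. Taking ε ≥ 2/κ below makes ε times the infimum
  -- at least 2, contradicting the bound 1.
  set κ := min (c / 4) (Δ / d ^ 2) with hκ
  have hκ0 : 0 < κ := lt_min (by positivity) (by positivity)
  have hDpos := eventually_pos_of_isTheta hp hR
  refine ⟨2 / κ, fun ε hε => ?_⟩
  filter_upwards [hfar, hgram.eventually_le_const hδ2, hDpos, eventually_ge_atTop 2]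
    with n h1 h2 h3 h4
  refine le_trans (measure_mono_ae ?_) ((measure_union_le _ _).trans
    ((add_le_add h1.le h2).trans (ENNReal.add_halves δ).le))
  have hmem : ∀ᵐ ω ∂μ n, ∀ i, (S n).α i ω ∈ A := ae_all_iff.2 fun i => hreg.ae_α_mem i
  have hne := hreg.ae_α_ne hr (n := n) (i := ⟨0, by omega⟩) (j := ⟨1, by omega⟩) (by simp)
  filter_upwards [hreg.smooth n, hbd n, hmem, hne] with ω g1 g2 g3 g4 hω
  by_contra hcon
  change ε * |_| ≤ |(1 : ℝ)| at hω
  have c1 : ∀ i j : Fin n, η < ‖(S n).α i ω - (S n).α j ω‖ →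
      Δ ≤ sqDist ((S n).colH (R n) i ω) ((S n).colH (R n) j ω) := by
    intro i j hij
    by_contra hlt
    exact hcon (Or.inl ⟨i, j, not_le.1 hlt, hij⟩)
  have c2 : ∀ i : Fin n, c ≤ sMin ((S n).gram A (R n) ω ((S n).α i ω)) := by
    by_contra hlt
    exact hcon (Or.inr hlt)
  -- An infimum over no pairs would be 0 in ℝ and defeat the lower bound; hence n ≥ 2 and two almost
  -- surely distinct latent variables.
  have : Nonempty {q : Fin n × Fin n // (S n).α q.1 ω ≠ (S n).α q.2 ω} := ⟨⟨(_, _), g4⟩⟩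
  have hinf : κ ≤ ⨅ q : {q : Fin n × Fin n // (S n).α q.1 ω ≠ (S n).α q.2 ω},
        sqDist ((S n).colH (R n) q.1.1 ω) ((S n).colH (R n) q.1.2 ω)
          / ‖(S n).α q.1.1 ω - (S n).α q.1.2 ω‖ ^ (2 : ℝ) := by
    refine le_ciInf fun q => ?_
    have hpos : 0 < ‖(S n).α q.1.1 ω - (S n).α q.1.2 ω‖ := norm_pos_iff.2 (sub_ne_zero.2 q.2)
    rw [Real.rpow_two, le_div_iff₀ (by positivity)]
    rcases lt_or_ge η ‖(S n).α q.1.1 ω - (S n).α q.1.2 ω‖ with hq | hq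
    · have hle : ‖(S n).α q.1.1 ω - (S n).α q.1.2 ω‖ ≤ d := by
        rw [← dist_eq_norm]
        have := Metric.dist_le_diam_of_mem hreg.isCompact.isBounded (g3 q.1.1) (g3 q.1.2)
        linarith
      refine le_trans ?_ (c1 _ _ hq)
      calc κ * ‖(S n).α q.1.1 ω - (S n).α q.1.2 ω‖ ^ 2 ≤ Δ / d ^ 2 * d ^ 2 := by
            gcongr
            exact min_le_right _ _
        _ = Δ := by field_simp
    · refine le_trans ?_ ((S n).le_sqDist_colH (R n) hm hreg.uniqueDiffOn hreg.convex g1 g2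
        (g3 _) (g3 _) h3 (c2 q.1.1) ?_)
      · gcongr
        exact min_le_left _ _
      · refine le_trans ?_ hη2
        gcongr
  rw [abs_one, abs_of_nonneg (hκ0.le.trans hinf)] at hω
  have h5 : 2 / κ * κ ≤ 1 := by
    refine le_trans ?_ hω
    have : 0 < 2 / κ := by positivity
    gcongr
    linarith
  rw [div_mul_cancel₀ _ hκ0.ne'] at h5
  norm_num at h5

end Regularities

end NonlinearFactor

theorem mainTheorem6 {r : ℕ} (hr : 0 < r) {m : ℕ} (hm : 2 ≤ m) {ν : ℝ} (hν : 0 < ν) (σ : ℝ)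
    (A : Set (EuclideanSpace ℝ (Fin r)))
    {Ω : ℕ → Type*} [∀ n, MeasurableSpace (Ω n)]
    (μ : ∀ n, Measure (Ω n)) [∀ n, IsProbabilityMeasure (μ n)]
    (p : ℕ → ℕ) (hp : Tendsto p atTop atTop)
    (S : ∀ n, NonlinearFactor.Sample r n (p n) (Ω n))
    (R : ∀ n, Finset (Fin (p n)))
    (hR : (fun n => ((R n).card : ℝ)) =Θ[atTop] fun n => (p n : ℝ))
    (hRc : (fun n => (((R n)ᶜ).card : ℝ)) =Θ[atTop] fun n => (p n : ℝ))
    (hreg : NonlinearFactor.Regularities μ S A m ν)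
    (h_i : ∀ n, ∀ i : Fin n, ∀ᵐ ω ∂μ n,
      (∑ l ∈ R n, (S n).condMoment (μ n) 2 i l ω) / ((R n).card : ℝ≥0∞) = ENNReal.ofReal (σ ^ 2))
    (h_ii : NonlinearFactor.StochBounded μ fun n ω =>
      ⨆ i, ⨆ l ∈ R n, (S n).condMoment (μ n) (4 + 2 * ν) i l ω)
    (h_iii : ∀ ε : ℝ, 0 < ε →
      Tendsto (fun Δ : ℝ => limsup (fun n : ℕ => μ n {ω | ∃ i j : Fin n,
          NonlinearFactor.sqDist ((S n).colH (R n) i ω) ((S n).colH (R n) j ω) < Δ ∧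
          ε < ‖(S n).α i ω - (S n).α j ω‖}) atTop)
        (𝓝[>] 0) (𝓝 0))
    (h_iv : ∃ c : ℝ, 0 < c ∧
      Tendsto (fun n : ℕ => μ n {ω | ¬ ∀ i : Fin n,
          c ≤ NonlinearFactor.sMin ((S n).gram A (R n) ω ((S n).α i ω))}) atTop (𝓝 0))
    (hrate : (fun n : ℕ => (n : ℝ) ^ (4 / ν) * Real.log n ^ ((ν - 2) / ν) / (p n : ℝ))
      =O[atTop] fun _ => (1 : ℝ)) :
    NonlinearFactor.IndirectMatching μ S R (fun _ => NonlinearFactor.sqDist)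
      (2 * σ ^ 2) 2 2 (fun n => (Real.log n / (p n : ℝ)) ^ ((1 : ℝ) / 4)) := by
  refine ⟨by positivity, two_pos, two_pos, ?_, tendsto_log_div_rpow hν hp hrate,
    hreg.bigOP_denoising hν σ hp hR h_i h_ii hrate, hreg.bigOP_sqDist_div hm R,
    hreg.bigOP_one_sqDist_div hr hm hp hR h_iii h_iv⟩
  obtain ⟨K, _, h⟩ := exists_rpow_mul_log_le hp hrate
  filter_upwards [h] with n ⟨_, hl, hp0, _⟩
  positivity
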